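/- Let $M$ be a smooth (Hausdorff, second countable) $(2n+1)$-dimensional manifold with a contact distribution $\mathcal H$, i.e. a distribution that is locally the kernel of a contact form (a smooth 1-form $\alpha$ with $\alpha\wedge(d\alpha)^n$ nowhere zero). Let $\pi: M\to W$ be a proper submersion to a smooth $p$-dimensional manifold $W$, and let $\mathcal F=\ker\pi_*$. Suppose that $(M,\mathcal H,\mathcal X)$ is a complete pre-isotropic contact structure related to $\pi$, which means: - $\mathcal F$ is transversal to $\mathcal H$, and $\mathcal F\cap\mathcal H$ is isotropic in $\mathcal H$, i.e. $d\alpha$ vanishes on it for every local contact form $\alpha$ with $\mathcal H=\ker\alpha$; - $\mathcal X$ is an Abelian Lie algebra of infinitesimal contact automorphisms of $\mathcal H$ (smooth vector fields $X$ on $M$ such that, for every local contact form $\alpha$ defining $\mathcal H$, $\mathcal L_X\alpha=\lambda\alpha$ for some smooth function $\lambda$) whose orbits are the connected components of the fibers of $\pi$. Here the orbit of a point consists of the points that can be reached from it along finitely many integral curves of elements of $\mathcal X$. Then every point of $M$ has an open, $\mathcal X$-invariant neighborhood $U$ (that is, $U$ is a union of orbits) and a contact form $\alpha_U$ on $U$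 with $\mathcal H|_U=\ker\alpha_U$ such that: (i) $\alpha_U$ is invariant under all elements of $\mathcal X$: $\mathcal L_X\alpha_U=0$ on $U$ for all $X\in\mathcal X$; (ii) $\mathcal F|_U$ is $\alpha_U$-complete: for any two first integrals $f_1,f_2$ of $\mathcal F$ on an open subset $V$ of $U$ (smooth functions on $V$, possibly constant, whose differentials vanish on $\mathcal F$), the Jacobi bracket $[f_1,f_2]$ is again a first integral of $\mathcal F$ on $V$. Here $[f_1,f_2]=\alpha_U([X_{f_1},X_{f_2}])$, where $X_f$ is the contact Hamiltonian vector field of $f$: the unique vector field with $\alpha_U(X_f)=f$ and $i_{X_f}d\alpha_U=df(Z)\,\alpha_U-df$, $Z$ being the Reeb vector field of $\alpha_U$ ($\alpha_U(Z)=1$, $i_Zd\alpha_U=0$). -/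

import Mathlib

open scoped Manifold ContDiff

noncomputable section

namespace ContactGeometry

/-- The model space `ℝᵐ`. -/
abbrev Model (m : ℕ) : Type := EuclideanSpace ℝ (Fin m)

section Calculus

variable {m : ℕ} {M : Type*} [TopologicalSpace M] [ChartedSpace (Model m) M]

/-- The tangent space of the `m`-manifold `M` at `x`. -/
abbrev Tan (m : ℕ) {M : Type*} [TopologicalSpace M] [ChartedSpace (Model m) M] (x : M) : Type :=
  TangentSpace (𝓡 m) x

/-- (Not necessarily continuous) vector fields. A field that is of interest only on an open set
takes arbitrary values elsewhere. -/
abbrev VField (m : ℕ) (M : Type*) [TopologicalSpace M] [ChartedSpace (Model m) M] : Type _ :=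
  (x : M) → Tan m x

/-- (Not necessarily continuous) differential 1-forms. A form that is of interest only on an open
set takes arbitrary values elsewhere. -/
abbrev OneForm (m : ℕ) (M : Type*) [TopologicalSpace M] [ChartedSpace (Model m) M] : Type _ :=
  (x : M) → (Tan m x →L[ℝ] ℝ)

/-- Distributions of tangent subspaces. -/
abbrev Distribution (m : ℕ) (M : Type*) [TopologicalSpace M] [ChartedSpace (Model m) M] : Type _ :=
  (x : M) → Submodule ℝ (Tan m x)

/-- The vector field `X` is smooth on `U`. -/
def SmoothFieldOn [IsManifold (𝓡 m) ∞ M] (X : VField m M) (U : Set M) : Prop :=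
  ContMDiffOn (𝓡 m) (𝓡 m).tangent ∞
    (fun x => Bundle.TotalSpace.mk' (Model m) (E := fun y : M => TangentSpace (𝓡 m) y) x (X x)) U

/-- The 1-form `α` is smooth on `U`, as a section of the cotangent bundle. -/
def SmoothFormOn [IsManifold (𝓡 m) ∞ M] (α : OneForm m M) (U : Set M) : Prop :=
  ContMDiffOn (𝓡 m) ((𝓡 m).prod 𝓘(ℝ, Model m →L[ℝ] ℝ)) ∞
    (fun x => Bundle.TotalSpace.mk' (Model m →L[ℝ] ℝ)
      (E := fun y : M => TangentSpace (𝓡 m) y →L[ℝ] Bundle.Trivial M ℝ y) x (α x)) U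

/-- The differential at `x` of a real function. -/
def diff (f : M → ℝ) (x : M) : Tan m x →L[ℝ] ℝ := mfderiv (𝓡 m) 𝓘(ℝ, ℝ) f x

/-- The local expression of the 1-form `α` in the chart around `x₀`: its pullback by the inverse of
that chart. -/
def localExpr (α : OneForm m M) (x₀ : M) (y : Model m) : Model m →L[ℝ] ℝ :=
  (α ((extChartAt (𝓡 m) x₀).symm y)).comp
    (mfderiv 𝓘(ℝ, Model m) (𝓡 m) (extChartAt (𝓡 m) x₀).symm y)

/-- The exterior derivative `dα` at `x`, as a bilinear form, computed in the chart around `x`, with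
the convention `dα(X, Y) = X(α(Y)) - Y(α(X)) - α([X, Y])`. -/
def extD (α : OneForm m M) (x : M) : Tan m x →L[ℝ] Tan m x →L[ℝ] ℝ :=
  let D : Model m →L[ℝ] Model m →L[ℝ] ℝ :=
    fderiv ℝ (localExpr α x) (extChartAt (𝓡 m) x x)
  let A : Model m →L[ℝ] Model m := mfderiv (𝓡 m) 𝓘(ℝ, Model m) (extChartAt (𝓡 m) x) x
  let B : Model m →L[ℝ] Model m →L[ℝ] ℝ := (D - D.flip).bilinearComp A A
  B

/-- The Lie derivative `L_X α = i_X dα + d(i_X α)` at `x`. -/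
def lieD (X : VField m M) (α : OneForm m M) (x : M) : Tan m x →L[ℝ] ℝ :=
  extD α x (X x) + diff (fun y => α y (X y)) x

/-- The commutator `[X, Y]` of vector fields. -/
def bracket (X Y : VField m M) : VField m M := VectorField.mlieBracket (𝓡 m) X Y

end Calculus

section Contact

variable {n : ℕ} {M : Type*} [TopologicalSpace M] [ChartedSpace (Model (2 * n + 1)) M]

/-- The value on `v` of the top-degree form `a ∧ bⁿ`, up to the nonzero constant factor which
depends on the normalization of the wedge product. -/
def wedgePow {V : Type*} (n : ℕ) (a : V → ℝ) (b : V → V → ℝ) (v : Fin (2 * n + 1) → V) : ℝ :=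
  ∑ σ : Equiv.Perm (Fin (2 * n + 1)), ((Equiv.Perm.sign σ : ℤ) : ℝ) *
    (a (v (σ 0)) * ∏ i : Fin n,
      b (v (σ ⟨2 * i.val + 1, by omega⟩)) (v (σ ⟨2 * i.val + 2, by omega⟩)))

/-- `α` is a contact form on `U`: it is smooth and `α ∧ (dα)ⁿ` vanishes nowhere. -/
def IsContactFormOn [IsManifold (𝓡 (2 * n + 1)) ∞ M] (α : OneForm (2 * n + 1) M) (U : Set M) :
    Prop :=
  SmoothFormOn α U ∧ ∀ x ∈ U, ∃ v : Fin (2 * n + 1) → Tan (2 * n + 1) x,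
    wedgePow n (fun u => α x u) (fun u w => extD α x u w) v ≠ 0

/-- `α` is a local contact form on the open set `U` which represents the distribution `H` there. -/
structure Represents [IsManifold (𝓡 (2 * n + 1)) ∞ M] (α : OneForm (2 * n + 1) M) (U : Set M)
    (H : Distribution (2 * n + 1) M) : Prop where
  isOpen : IsOpen U
  contact : IsContactFormOn α U
  ker_eq : ∀ x ∈ U, ∀ v : Tan (2 * n + 1) x, v ∈ H x ↔ α x v = 0

/-- `H` is a contact distribution: it is locally the kernel of a contact form. -/
def IsContactDistribution [IsManifold (𝓡 (2 * n + 1)) ∞ M] (H : Distribution (2 * n + 1) M) :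
    Prop :=
  ∀ x : M, ∃ (U : Set M) (α : OneForm (2 * n + 1) M), x ∈ U ∧ Represents α U H

/-- `X` is an infinitesimal automorphism of the contact distribution `H` (a contact vector field):
it is smooth, and `L_X α = c α`, `c` a smooth function, for each local contact form representing
`H`. -/
def IsContactField [IsManifold (𝓡 (2 * n + 1)) ∞ M] (H : Distribution (2 * n + 1) M)
    (X : VField (2 * n + 1) M) : Prop :=
  SmoothFieldOn X Set.univ ∧
    ∀ (U : Set M) (α : OneForm (2 * n + 1) M), Represents α U H →
      ∃ c : M → ℝ, ContMDiffOn (𝓡 (2 * n + 1)) 𝓘(ℝ, ℝ) ∞ c U ∧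
        ∀ x ∈ U, lieD X α x = c x • α x

end Contact

section Jacobi

variable {m : ℕ} {M : Type*} [TopologicalSpace M] [ChartedSpace (Model m) M]

/-- The map `v ↦ α(v) α - i_v dα` from tangent vectors to covectors, invertible if `α` is a contact
form. It carries the Reeb vector to `α`, and on horizontal vectors it is `v ↦ - i_v dα`. -/
def flat (α : OneForm m M) (x : M) : Tan m x →L[ℝ] (Tan m x →L[ℝ] ℝ) :=
  (α x).smulRight (α x) - extD α x

/-- The inverse of `flat`. On semi-basic covectors it is the inverse `α^♯` of the isomorphism
`v ↦ - i_v dα` from horizontal vectors to semi-basic covectors. -/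
def sharp (α : OneForm m M) (x : M) : (Tan m x →L[ℝ] ℝ) →L[ℝ] Tan m x :=
  (flat α x).inverse

/-- The Reeb vector field `Z` of the contact form `α`: `α(Z) = 1` and `i_Z dα = 0`. -/
def reeb (α : OneForm m M) : VField m M := fun x => sharp α x (α x)

/-- The contact Hamiltonian vector field `X_f = f Z + α^♯(df - df(Z) α)`. -/
def hamField (α : OneForm m M) (f : M → ℝ) : VField m M := fun x =>
  f x • reeb α x + sharp α x (diff f x - diff f x (reeb α x) • α x)

/-- The Jacobi bracket `[f, g] = α([X_f, X_g])`. -/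
def jacobi (α : OneForm m M) (f g : M → ℝ) : M → ℝ := fun x =>
  α x (bracket (hamField α f) (hamField α g) x)

/-- `f` is a first integral on `V` of the foliation with tangent distribution `F`. -/
def IsFirstIntegral (F : Distribution m M) (V : Set M) (f : M → ℝ) : Prop :=
  ContMDiffOn (𝓡 m) 𝓘(ℝ, ℝ) ∞ f V ∧ ∀ x ∈ V, ∀ v ∈ F x, diff f x v = 0

/-- The foliation `F`, restricted to the open set `U`, is `α`-complete: the Jacobi bracket of any
two first integrals, defined on any open subset of `U` (in particular on `U`), is a first
integral. -/
def IsAlphaComplete (α : OneForm m M) (F : Distribution m M) (U : Set M) : Prop :=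
  ∀ V : Set M, IsOpen V → V ⊆ U → ∀ f g : M → ℝ,
    IsFirstIntegral F V f → IsFirstIntegral F V g → IsFirstIntegral F V (jacobi α f g)

end Jacobi

section Orbits

variable {m : ℕ} {M : Type*} [TopologicalSpace M] [ChartedSpace (Model m) M]

/-- `y` is reached from `x` along one integral curve of an element of `𝒳`. -/
def FlowStep (𝒳 : Submodule ℝ (VField m M)) (x y : M) : Prop :=
  ∃ X ∈ 𝒳, ∃ (γ : ℝ → M) (a b : ℝ), a ≤ b ∧
    IsMIntegralCurveOn (I := 𝓡 m) γ X (Set.Icc a b) ∧ γ a = x ∧ γ b = y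

/-- The orbit of `x` under `𝒳`: the points reached from `x` along finitely many integral curves of
elements of `𝒳`. As `-X ∈ 𝒳` for `X ∈ 𝒳`, curves may be followed in both directions. -/
def orbit (𝒳 : Submodule ℝ (VField m M)) (x : M) : Set M :=
  {y | Relation.ReflTransGen (FlowStep 𝒳) x y}

/-- `U` is `𝒳`-invariant. -/
def IsInvariantSet (𝒳 : Submodule ℝ (VField m M)) (U : Set M) : Prop :=
  ∀ x ∈ U, orbit 𝒳 x ⊆ U

end Orbits

section PreIsotropic

variable {n : ℕ} {M : Type*} [TopologicalSpace M] [ChartedSpace (Model (2 * n + 1)) M]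

/-- The distribution `F = ker π_*`, tangent to the fibers of `π`. -/
def vertical (p : ℕ) {W : Type*} [TopologicalSpace W] [ChartedSpace (Model p) W] (π : M → W) :
    Distribution (2 * n + 1) M := fun x =>
  (mfderiv (𝓡 (2 * n + 1)) (𝓡 p) π x).ker

/-- `F` is pre-isotropic with respect to the contact distribution `H`: it is transversal to `H`,
and `F ∩ H` is isotropic for the conformal class of the forms `dα` restricted to `H`. -/
structure IsPreIsotropic [IsManifold (𝓡 (2 * n + 1)) ∞ M] (H F : Distribution (2 * n + 1) M) :
    Prop where
  transversal : ∀ x, F x ⊔ H x = ⊤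
  isotropic : ∀ (U : Set M) (α : OneForm (2 * n + 1) M), Represents α U H →
    ∀ x ∈ U, ∀ u ∈ F x ⊓ H x, ∀ v ∈ F x ⊓ H x, extD α x u v = 0

/-- `(M, H, 𝒳)` is a complete pre-isotropic contact structure related to the proper submersion
`π : M → W`, the foliation being `F = ker π_*`. The leaves of `F`, that is the connected components
of the fibers of `π`, are the orbits of `𝒳`. -/
structure IsCompletePreIsotropic [IsManifold (𝓡 (2 * n + 1)) ∞ M]
    (p : ℕ) {W : Type*} [TopologicalSpace W] [ChartedSpace (Model p) W] [IsManifold (𝓡 p) ∞ W]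
    (H : Distribution (2 * n + 1) M) (𝒳 : Submodule ℝ (VField (2 * n + 1) M)) (π : M → W) :
    Prop where
  contact : IsContactDistribution H
  submersion : Manifold.IsSubmersion (𝓡 (2 * n + 1)) (𝓡 p) ∞ π
  proper : IsProperMap π
  preIsotropic : IsPreIsotropic H (vertical p π)
  contactField : ∀ X ∈ 𝒳, IsContactField H X
  abelian : ∀ X ∈ 𝒳, ∀ Y ∈ 𝒳, ∀ x, bracket X Y x = 0
  orbit_eq : ∀ x, orbit 𝒳 x = connectedComponentIn (π ⁻¹' {π x}) x

end PreIsotropic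

end ContactGeometry

end

open scoped Manifold ContDiff

noncomputable section

namespace ContactGeometry

/-! Choose `Z ∈ 𝒳` with `Z x₀ ∉ H x₀` and divide a local contact form `β` by `β(Z)`. The quotient
`α` does not depend on `β`, because two forms with the same kernel are proportional; it is a contact
form on `U = {x | Z x ∉ H x}`, and `α(Z) = 1` there. Along an integral curve of `X ∈ 𝒳` the function
`β(Z)` solves a linear equation `w' = c w`, since `X` is a contact field and `[X, Z] = 0`; its zeros
therefore propagate, and `U` is invariant. Evaluating `L_X α = c α` on `Z` gives `c = X(1) - α([X,
Z]) = 0`, which is (i). For `X = Z` this says that `i_Z dα = 0`, so `Z` is the Reeb field of `α`.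

For (ii), let `f` be a first integral. Then `df(Z) = 0`, so `α(X_f) = f` and `L_{X_f} α = 0`. For `Y
∈ 𝒳` the bracket `[Y, X_f]` preserves `α`, and `α([Y, X_f]) = Y(f) = 0`; thus it is annihilated by
`α` and by `dα`, and vanishes. By the Jacobi identity `Y` commutes with `[X_f, X_g]`, and invariance
of `α` gives `Y(α([X_f, X_g])) = 0`. These arguments are `mem_iff_of_mem_orbit`,
`exists_normalized_form`, `lieD_eq_zero_of_normalized` and `isAlphaComplete_of_lieD_eq_zero`.

Both the existence of `Z` and the last step need `𝒳` to span `ker π_*` pointwise, whereas the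
hypothesis concerns orbits only. This is `exists_eq_of_mfderiv_eq_zero`, the longest part. A field
of `𝒳` that vanishes at one point vanishes on the whole orbit, so the orbit is already swept out by
a finite-dimensional commuting family. Such a family integrates to local actions
(`exists_integral_of_comm`, `exists_isPlaque`), and by second countability countably many of their
images, the plaques, cover the orbit. If the values of `𝒳` at `x` did not fill the tangent space of
the fiber, each plaque would project to a null set in a complement of the base directions, while a
piece of the fiber component projects onto a set containing a ball. -/

open Set Metric Topology Filter NNReal

/-! ### Uniqueness and confinement for ordinary differential equations -/

section ODE

variable {E : Type*} [NormedAddCommGroup E] [NormedSpace ℝ E]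

/-- Two solutions of an ordinary differential equation on a compact interval agree at all points
or nowhere. -/
theorem ode_eqOn_of_eq {v : ℝ → E → E} {S : ℝ → Set E} {K : ℝ≥0} {f g : ℝ → E} {a b t₀ : ℝ}
    (hv : ∀ t ∈ Icc a b, LipschitzOnWith K (v t) (S t))
    (hf : ∀ t ∈ Icc a b, HasDerivWithinAt f (v t (f t)) (Icc a b) t)
    (hfs : ∀ t ∈ Icc a b, f t ∈ S t)
    (hg : ∀ t ∈ Icc a b, HasDerivWithinAt g (v t (g t)) (Icc a b) t)
    (hgs : ∀ t ∈ Icc a b, g t ∈ S t) (ht₀ : t₀ ∈ Icc a b) (heq : f t₀ = g t₀) :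
    EqOn f g (Icc a b) := by
  have hcf : ContinuousOn f (Icc a b) := fun t ht => (hf t ht).continuousWithinAt
  have hcg : ContinuousOn g (Icc a b) := fun t ht => (hg t ht).continuousWithinAt
  have hr : ∀ {h : ℝ → E} {h' : E} {t : ℝ}, t ∈ Ico t₀ b →
      HasDerivWithinAt h h' (Icc a b) t → HasDerivWithinAt h h' (Ici t) t := by
    intro h h' t ht hh
    refine hh.mono_of_mem_nhdsWithin (mem_nhdsWithin.2 ⟨Iio b, isOpen_Iio, ht.2, ?_⟩)
    rintro s ⟨hs, hs'⟩
    exact ⟨ht₀.1.trans (ht.1.trans hs'), le_of_lt hs⟩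
  have hl : ∀ {h : ℝ → E} {h' : E} {t : ℝ}, t ∈ Ioc a t₀ →
      HasDerivWithinAt h h' (Icc a b) t → HasDerivWithinAt h h' (Iic t) t := by
    intro h h' t ht hh
    refine hh.mono_of_mem_nhdsWithin (mem_nhdsWithin.2 ⟨Ioi a, isOpen_Ioi, ht.1, ?_⟩)
    rintro s ⟨hs, hs'⟩
    exact ⟨le_of_lt hs, le_trans hs' (ht.2.trans ht₀.2)⟩
  have hsr : Ico t₀ b ⊆ Icc a b := fun t ht => ⟨ht₀.1.trans ht.1, ht.2.le⟩
  have hsl : Ioc a t₀ ⊆ Icc a b := fun t ht => ⟨ht.1.le, ht.2.trans ht₀.2⟩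
  rw [← Icc_union_Icc_eq_Icc ht₀.1 ht₀.2]
  refine EqOn.union ?_ ?_
  · exact ODE_solution_unique_of_mem_Icc_left (fun t ht => hv t (hsl ht))
      (hcf.mono (Icc_subset_Icc_right ht₀.2)) (fun t ht => hl ht (hf t (hsl ht)))
      (fun t ht => hfs t (hsl ht)) (hcg.mono (Icc_subset_Icc_right ht₀.2))
      (fun t ht => hl ht (hg t (hsl ht))) (fun t ht => hgs t (hsl ht)) heq
  · exact ODE_solution_unique_of_mem_Icc_right (fun t ht => hv t (hsr ht))
      (hcf.mono (Icc_subset_Icc_left ht₀.1)) (fun t ht => hr ht (hf t (hsr ht)))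
      (fun t ht => hfs t (hsr ht)) (hcg.mono (Icc_subset_Icc_left ht₀.1))
      (fun t ht => hr ht (hg t (hsr ht))) (fun t ht => hgs t (hsr ht)) heq

/-- A solution of a homogeneous linear equation which vanishes at a point is zero. -/
theorem linear_ode_eq_zero {L : ℝ → E →L[ℝ] E} {K : ℝ≥0} {f : ℝ → E} {a b t₀ : ℝ}
    (hL : ∀ t ∈ Icc a b, ‖L t‖ ≤ K)
    (hf : ∀ t ∈ Icc a b, HasDerivWithinAt f (L t (f t)) (Icc a b) t)
    (ht₀ : t₀ ∈ Icc a b) (h0 : f t₀ = 0) : ∀ t ∈ Icc a b, f t = 0 := by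
  have := ode_eqOn_of_eq (v := fun t => L t) (S := fun _ => univ) (K := K) (g := fun _ => 0)
    (fun t ht => ((L t).lipschitz.weaken (by exact_mod_cast hL t ht)).lipschitzOnWith) hf
    (fun _ _ => mem_univ _)
    (fun t ht => by simpa using hasDerivWithinAt_const t (Icc a b) (0 : E))
    (fun _ _ => mem_univ _) ht₀ h0
  exact fun t ht => this ht

/-- A solution of an autonomous equation which is bounded and Lipschitz on a large ball exists
and stays in that ball. -/
theorem exists_solution_mem_closedBall [CompleteSpace E] {f : E → E} {y₀ y : E} {R r L K : ℝ≥0}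
    (hb : ∀ x ∈ closedBall y₀ R, ‖f x‖ ≤ L) (hl : LipschitzOnWith K f (closedBall y₀ R))
    (hLR : (L : ℝ) ≤ R - r) (hy : y ∈ closedBall y₀ r) :
    ∃ γ : ℝ → E, γ 0 = y ∧ (∀ t, γ t ∈ closedBall y₀ R) ∧
      ∀ t ∈ Icc (0 : ℝ) 1, HasDerivWithinAt γ (f (γ t)) (Icc 0 1) t := by
  have hpl : IsPicardLindelof (fun _ => f) (⟨0, by simp⟩ : Icc (0 : ℝ) 1) y₀ R r L K :=
    IsPicardLindelof.of_time_independent hb hl (by simpa using hLR)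
  obtain ⟨α, hα⟩ := ODE.FunSpace.exists_isFixedPt_next hpl hy
  -- `compProj` extends the fixed point by clamping time to the unit interval, so the confinement
  -- holds for every real `t`.
  have hmem : ∀ t, α.compProj t ∈ closedBall y₀ R :=
    fun t => α.compProj_mem_closedBall hpl.mul_max_le
  refine ⟨α.compProj, ?_, hmem, fun t ht => ?_⟩
  · have := α.compProj_val (t := ⟨0, by simp⟩)
    simp only at this
    rw [this, ← hα, ODE.FunSpace.next_apply₀]
  · have h1 := ODE.hasDerivWithinAt_picard_Icc (t₀ := 0) (by simp) hpl.continuousOn_uncurry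
      α.continuous_compProj.continuousOn (fun t _ => hmem t) y ht
    refine h1.congr_of_mem (fun t' ht' => ?_) ht
    nth_rw 1 [← hα]
    rw [ODE.FunSpace.compProj_of_mem ht', ODE.FunSpace.next_apply]

end ODE

/-! ### Integration of commuting fields: the equation `dΦ = Θ(Φ)` -/

section TotalDifferentialEquation

variable {P E : Type*} [NormedAddCommGroup P] [NormedSpace ℝ P] [NormedAddCommGroup E]
  [NormedSpace ℝ E]

/-- Local bounds for a map of class `C²`. -/
theorem exists_uniform_bounds {F : Type*} [NormedAddCommGroup F] [NormedSpace ℝ F]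
    {Θ : E → F} {y₀ : E} {U : Set E} (hU : U ∈ 𝓝 y₀) (hΘ : ContDiffAt ℝ 2 Θ y₀) :
    ∃ ρ > 0, ∃ C : ℝ≥0, 1 ≤ C ∧ ball y₀ ρ ⊆ U ∧
      (∀ y ∈ ball y₀ ρ, HasFDerivAt Θ (fderiv ℝ Θ y) y) ∧
      (∀ y ∈ ball y₀ ρ, ‖Θ y‖ ≤ C) ∧ (∀ y ∈ ball y₀ ρ, ‖fderiv ℝ Θ y‖ ≤ C) ∧
      LipschitzOnWith C (fderiv ℝ Θ) (ball y₀ ρ) := by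
  obtain ⟨K, s, hs, hK⟩ := (hΘ.fderiv_right (m := 1) (by norm_num)).exists_lipschitzOnWith
  have h1 : ∀ᶠ y in 𝓝 y₀, HasFDerivAt Θ (fderiv ℝ Θ y) y :=
    (hΘ.eventually (by simp)).mono fun y hy => (hy.differentiableAt (by simp)).hasFDerivAt
  have h2 : ∀ᶠ y in 𝓝 y₀, ‖Θ y‖ < ‖Θ y₀‖ + 1 :=
    hΘ.continuousAt.norm.eventually_lt continuousAt_const (by simp)
  have h3 : ∀ᶠ y in 𝓝 y₀, ‖fderiv ℝ Θ y‖ < ‖fderiv ℝ Θ y₀‖ + 1 :=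
    (hΘ.fderiv_right (m := 1) (by norm_num)).continuousAt.norm.eventually_lt continuousAt_const
      (by simp)
  obtain ⟨ρ, hρ, hball⟩ := Metric.eventually_nhds_iff_ball.1
    (h1.and (h2.and (h3.and ((show ∀ᶠ y in 𝓝 y₀, y ∈ s from hs).and
      (show ∀ᶠ y in 𝓝 y₀, y ∈ U from hU)))))
  refine ⟨ρ, hρ, K + ‖Θ y₀‖₊ + ‖fderiv ℝ Θ y₀‖₊ + 1, le_add_self,
    fun y hy => (hball y hy).2.2.2.2, fun y hy => (hball y hy).1, fun y hy => ?_, fun y hy => ?_,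
    (hK.mono fun y hy => (hball y hy).2.2.2.1).weaken ?_⟩
  · have := (hball y hy).2.1.le
    push_cast
    nlinarith [K.2, norm_nonneg (fderiv ℝ Θ y₀)]
  · have := (hball y hy).2.2.1.le
    push_cast
    nlinarith [K.2, norm_nonneg (Θ y₀)]
  · rw [add_assoc, add_assoc]
    exact le_self_add

/-- Second order Taylor estimate on a ball. -/
theorem norm_taylor_le {F : Type*} [NormedAddCommGroup F] [NormedSpace ℝ F]
    {Θ : E → F} {y₀ : E} {ρ : ℝ} {C : ℝ≥0}
    (hd : ∀ y ∈ ball y₀ ρ, HasFDerivAt Θ (fderiv ℝ Θ y) y)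
    (hl : LipschitzOnWith C (fderiv ℝ Θ) (ball y₀ ρ)) {y h : E}
    (hy : y ∈ ball y₀ ρ) (hyh : y + h ∈ ball y₀ ρ) :
    ‖Θ (y + h) - Θ y - fderiv ℝ Θ y h‖ ≤ C * ‖h‖ * ‖h‖ := by
  have hseg : segment ℝ y (y + h) ⊆ ball y₀ ρ := (convex_ball y₀ ρ).segment_subset hy hyh
  have := (convex_segment (𝕜 := ℝ) y (y + h)).norm_image_sub_le_of_norm_hasFDerivWithin_le'
    (f := Θ) (f' := fderiv ℝ Θ) (φ := fderiv ℝ Θ y) (C := C * ‖h‖)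
    (fun z hz => (hd z (hseg hz)).hasFDerivWithinAt) (fun z hz => ?_)
    (left_mem_segment ℝ y (y + h)) (right_mem_segment ℝ y (y + h))
  · simpa using this
  · rw [← dist_eq_norm]
    refine (hl.dist_le_mul z (hseg hz) y hy).trans ?_
    gcongr
    rw [dist_eq_norm]
    have := norm_sub_le_of_mem_segment hz
    simpa using this

/-- Local solvability of the total differential equation `dΦ = Θ(Φ)`, if `Θ` satisfies the
integrability condition that the vector fields `y ↦ Θ y a` commute. -/
theorem exists_integral_of_comm [CompleteSpace E] {Θ : E → P →L[ℝ] E} {y₀ : E} {U : Set E}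
    (hU : U ∈ 𝓝 y₀) (hΘ : ContDiffAt ℝ 2 Θ y₀)
    (hcomm : ∀ y ∈ U, ∀ a b, fderiv ℝ Θ y (Θ y a) b = fderiv ℝ Θ y (Θ y b) a) :
    ∃ ε > 0, ∃ r > 0, ∀ y ∈ ball y₀ r, ∃ Φ : P → E, Φ 0 = y ∧
      ∀ a ∈ ball (0 : P) ε, Φ a ∈ U ∧ HasFDerivAt Φ (Θ (Φ a)) a := by
  obtain ⟨ρ, hρ, C, hC1, hρU, hd, hb, hdb, hl⟩ := exists_uniform_bounds hU hΘ
  have hC1' : (1 : ℝ) ≤ C := by exact_mod_cast hC1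
  have hC0 : (0 : ℝ) < C := by linarith
  have hlip : LipschitzOnWith C Θ (ball y₀ ρ) :=
    (convex_ball y₀ ρ).lipschitzOnWith_of_nnnorm_hasFDerivWithin_le
      (fun y hy => (hd y hy).hasFDerivWithinAt) (fun y hy => by exact_mod_cast hdb y hy)
  -- Starting points lie within `R` of `y₀`, solutions within `2R`, and the perturbed curves
  -- compared with them below within `4R`, which is less than `ρ`.
  set R : ℝ≥0 := ⟨ρ / 5, by positivity⟩ with hR
  have hRρ : (R : ℝ) = ρ / 5 := rfl
  have hR0 : (0 : ℝ) < R := by rw [hRρ]; positivity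
  -- The bound `R / C` keeps the speed below `R`, so that in unit time a solution moves by at most
  -- `R`; the bound `1` makes `C` a Lipschitz constant of `y ↦ Θ y a`.
  set ε : ℝ := min 1 (R / C) with hε
  have hε0 : 0 < ε := by positivity
  have hε1 : ε ≤ 1 := min_le_left _ _
  have hεR : C * ε ≤ R := by
    have : ε ≤ R / C := min_le_right _ _
    rwa [le_div_iff₀' hC0] at this
  have hsub : closedBall y₀ ((2 * R : ℝ≥0) : ℝ) ⊆ ball y₀ ρ := by
    apply closedBall_subset_ball; push_cast; rw [hRρ]; linarith
  have hlipa : ∀ a ∈ ball (0 : P) ε, LipschitzOnWith C (fun y => Θ y a) (ball y₀ ρ) := by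
    intro a ha
    rw [mem_ball_zero_iff] at ha
    refine LipschitzOnWith.of_dist_le_mul fun x hx y hy => ?_
    rw [dist_eq_norm, ← sub_apply]
    refine ((Θ x - Θ y).le_opNorm a).trans ?_
    have := hlip.dist_le_mul x hx y hy
    rw [dist_eq_norm (Θ x)] at this
    nlinarith [norm_nonneg (Θ x - Θ y), norm_nonneg a]
  refine ⟨ε, hε0, R, hR0, fun y hy => ?_⟩
  have hex : ∀ a ∈ ball (0 : P) ε, ∃ γ : ℝ → E, γ 0 = y ∧
      (∀ t, γ t ∈ closedBall y₀ ((2 * R : ℝ≥0) : ℝ)) ∧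
      ∀ t ∈ Icc (0 : ℝ) 1, HasDerivWithinAt γ (Θ (γ t) a) (Icc 0 1) t := by
    intro a ha
    refine exists_solution_mem_closedBall (f := fun y => Θ y a) (r := R) (L := R) ?_
      ((hlipa a ha).mono hsub) (by push_cast; linarith) (ball_subset_closedBall hy)
    intro x hx
    rw [mem_ball_zero_iff] at ha
    refine ((Θ x).le_opNorm a).trans (le_trans ?_ hεR)
    have := hb x (hsub hx)
    gcongr
  choose! γ hγ0 hγB hγ' using hex
  have h0 : (0 : P) ∈ ball (0 : P) ε := mem_ball_self hε0
  -- `Φ a` is the time-one value of the solution of `γ' = Θ(γ) a` which starts at `y`.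
  refine ⟨fun a => γ a 1, ?_, fun a ha => ⟨hρU (hsub (hγB a ha 1)), ?_⟩⟩
  · have := ode_eqOn_of_eq (v := fun _ _ => (0 : E)) (S := fun _ => univ) (K := 0) (a := 0) (b := 1)
      (f := γ 0) (g := fun _ => y) (t₀ := 0)
      (fun t _ => (LipschitzWith.const (0 : E)).lipschitzOnWith)
      (fun t ht => by simpa using hγ' 0 h0 t ht) (fun _ _ => mem_univ _)
      (fun t ht => hasDerivWithinAt_const t _ y) (fun _ _ => mem_univ _) (by simp) (hγ0 0 h0)
    exact this (by simp)
  -- the difference quotient estimate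
  set C' : ℝ := gronwallBound 0 C (2 * C ^ 3) 1 with hC'
  have key : ∀ b, a + b ∈ ball (0 : P) ε →
      ‖γ (a + b) 1 - γ a 1 - Θ (γ a 1) b‖ ≤ C' * ‖b‖ ^ 2 := by
    intro b hab
    have hna := mem_ball_zero_iff.1 ha
    have hnab := mem_ball_zero_iff.1 hab
    have hnb : ‖b‖ ≤ 2 * ε := by
      have : b = (a + b) - a := by abel
      rw [this]
      refine (norm_sub_le _ _).trans (by linarith)
    have hmem : ∀ t, γ a t ∈ ball y₀ ρ := fun t => hsub (hγB a ha t)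
    have hbnd : ∀ t ∈ Icc (0 : ℝ) 1, ‖t • Θ (γ a t) b‖ ≤ C * ‖b‖ := by
      intro t ht
      rw [norm_smul, Real.norm_of_nonneg ht.1]
      have h1 := (Θ (γ a t)).le_opNorm b
      have h2 := hb _ (hmem t)
      have h3 : ‖Θ (γ a t)‖ * ‖b‖ ≤ C * ‖b‖ := by gcongr
      nlinarith [ht.1, ht.2, norm_nonneg (Θ (γ a t) b)]
    have hvmem : ∀ t ∈ Icc (0 : ℝ) 1, γ a t + t • Θ (γ a t) b ∈ ball y₀ ρ := by
      intro t ht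
      have h1 := hbnd t ht
      have h2 := hγB a ha t
      rw [mem_closedBall, dist_eq_norm] at h2
      rw [mem_ball, dist_eq_norm]
      have h3 : (C : ℝ) * ‖b‖ ≤ 2 * R := by nlinarith
      have h4 := norm_add_le (γ a t - y₀) (t • Θ (γ a t) b)
      have h5 : γ a t + t • Θ (γ a t) b - y₀ = γ a t - y₀ + t • Θ (γ a t) b := by abel
      rw [h5]
      push_cast at h2
      linarith [hRρ]
    have hv' : ∀ t ∈ Icc (0 : ℝ) 1, HasDerivWithinAt (fun t => γ a t + t • Θ (γ a t) b)
        (Θ (γ a t) a + (t • fderiv ℝ Θ (γ a t) (Θ (γ a t) a) b + Θ (γ a t) b)) (Icc 0 1) t := by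
      intro t ht
      have h1 := hγ' a ha t ht
      have h2 : HasDerivWithinAt (fun t => Θ (γ a t) b) (fderiv ℝ Θ (γ a t) (Θ (γ a t) a) b)
          (Icc 0 1) t :=
        ((hd _ (hmem t)).comp_hasDerivWithinAt t h1).clm_apply (hasDerivWithinAt_const t _ b)
          |>.congr_deriv (by simp)
      refine (h1.add ((hasDerivWithinAt_id t _).smul h2)).congr_deriv ?_
      simp
    have hici : ∀ {h : ℝ → E} {h' : E} {t : ℝ}, t ∈ Ico (0 : ℝ) 1 →
        HasDerivWithinAt h h' (Icc 0 1) t → HasDerivWithinAt h h' (Ici t) t := by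
      intro h h' t ht hh
      refine hh.mono_of_mem_nhdsWithin (mem_nhdsWithin.2 ⟨Iio 1, isOpen_Iio, ht.2, ?_⟩)
      rintro s ⟨hs, hs'⟩
      exact ⟨ht.1.trans hs', le_of_lt hs⟩
    -- The curve `γ a t + t Θ(γ a t) b` solves the equation with parameter `a + b` up to an error of
    -- order `‖b‖²`. Grönwall's inequality bounds its distance to `γ (a + b)`, and at `t = 1` this
    -- is the differentiability estimate.
    have hG := dist_le_of_approx_trajectories_ODE_of_mem (a := 0) (b := 1) (K := C)
      (v := fun _ y => Θ y (a + b)) (s := fun _ => ball y₀ ρ)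
      (f := γ (a + b)) (f' := fun t => Θ (γ (a + b) t) (a + b))
      (g := fun t => γ a t + t • Θ (γ a t) b)
      (g' := fun t => Θ (γ a t) a + (t • fderiv ℝ Θ (γ a t) (Θ (γ a t) a) b + Θ (γ a t) b))
      (εf := 0) (εg := 2 * C ^ 3 * ‖b‖ ^ 2) (δ := 0)
      (fun t _ => hlipa _ hab)
      (fun t ht => (hγ' _ hab t ht).continuousWithinAt)
      (fun t ht => hici ht (hγ' _ hab t (Ico_subset_Icc_self ht))) (by simp)
      (fun t _ => hsub (hγB _ hab t)) (fun t ht => (hv' t ht).continuousWithinAt)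
      (fun t ht => hici ht (hv' t (Ico_subset_Icc_self ht))) ?_
      (fun t ht => hvmem t (Ico_subset_Icc_self ht)) (by simp [hγ0 a ha, hγ0 _ hab]) 1 (by simp)
    · rw [dist_eq_norm] at hG
      have h1 : γ (a + b) 1 - γ a 1 - Θ (γ a 1) b
          = γ (a + b) 1 - (γ a 1 + (1 : ℝ) • Θ (γ a 1) b) := by rw [one_smul]; abel
      rw [h1]
      refine hG.trans (le_of_eq ?_)
      rw [hC', gronwallBound_of_K_ne_0 hC0.ne', gronwallBound_of_K_ne_0 hC0.ne']
      simp only [zero_mul, zero_add, sub_zero]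
      ring
    · intro t ht'
      have ht := Ico_subset_Icc_self ht'
      set u := γ a t with hu
      set h := t • Θ u b with hh
      have hT := norm_taylor_le hd hl (hmem t) (hvmem t ht)
      set e := Θ (u + h) - Θ u - fderiv ℝ Θ u h with he
      -- Integrability enters here: exchanging `a` and `b` cancels the term of first order in `b`.
      -- What remains is quadratic in `b` or a Taylor remainder, each at most `C ^ 3 * ‖b‖ ^ 2`.
      have h1 : Θ u a + (t • fderiv ℝ Θ u (Θ u a) b + Θ u b) - Θ (u + h) (a + b)
          = -(t • fderiv ℝ Θ u (Θ u b) b) - e (a + b) := by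
        have : Θ (u + h) = e + Θ u + fderiv ℝ Θ u h := by rw [he]; abel
        rw [this, hcomm u (hρU (hmem t)) a b, hh]
        simp only [map_smul, add_apply, map_add,
          smul_apply]
        abel
      rw [dist_eq_norm, h1]
      have h2 : ‖t • fderiv ℝ Θ u (Θ u b) b‖ ≤ C ^ 2 * ‖b‖ ^ 2 := by
        have : t • fderiv ℝ Θ u (Θ u b) b = fderiv ℝ Θ u h b := by simp [hh]
        rw [this]
        refine ((fderiv ℝ Θ u h).le_opNorm b).trans ?_
        have i1 := (fderiv ℝ Θ u).le_opNorm h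
        have i2 := hdb u (hmem t)
        have i3 := hbnd t ht
        calc _ ≤ (C * (C * ‖b‖)) * ‖b‖ := by
              gcongr
              exact i1.trans (by gcongr)
          _ = _ := by ring
      have h3 : ‖e (a + b)‖ ≤ C ^ 3 * ‖b‖ ^ 2 := by
        refine (e.le_opNorm _).trans ?_
        have i3 := hbnd t ht
        calc ‖e‖ * ‖a + b‖ ≤ (C * (C * ‖b‖) * (C * ‖b‖)) * 1 := by
              gcongr
              · exact hT.trans (by gcongr)
              · linarith
          _ = _ := by ring
      have h4 : (C : ℝ) ^ 2 * ‖b‖ ^ 2 ≤ C ^ 3 * ‖b‖ ^ 2 := by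
        have := pow_le_pow_right₀ hC1' (show 2 ≤ 3 by norm_num)
        gcongr
      calc _ ≤ ‖-(t • fderiv ℝ Θ u (Θ u b) b)‖ + ‖e (a + b)‖ := norm_sub_le _ _
        _ ≤ _ := by rw [norm_neg]; linarith
  rw [hasFDerivAt_iff_isLittleO_nhds_zero]
  have hbig : (fun b => γ (a + b) 1 - γ a 1 - Θ (γ a 1) b) =O[𝓝 0] fun b => ‖b‖ ^ 2 := by
    refine Asymptotics.IsBigO.of_bound C' ?_
    have : ∀ᶠ b in 𝓝 (0 : P), a + b ∈ ball (0 : P) ε := by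
      have hc : ContinuousAt (fun b : P => a + b) 0 := by fun_prop
      exact hc.eventually (isOpen_ball.mem_nhds (by simpa using ha))
    filter_upwards [this] with b hb'
    simpa using key b hb'
  exact hbig.trans_isLittleO (Asymptotics.isLittleO_norm_pow_id one_lt_two)

end TotalDifferentialEquation

/-! ### Fields, brackets and directional derivatives in charts -/

section Charts

variable {m : ℕ} {M : Type*} [TopologicalSpace M] [ChartedSpace (Model m) M]

/-- The derivative at `z` of the chart around `x₀`. -/
def chartD (x₀ z : M) : Model m →L[ℝ] Model m :=
  mfderiv (𝓡 m) 𝓘(ℝ, Model m) (extChartAt (𝓡 m) x₀) z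

/-- The derivative at `y` of the inverse of the chart around `x₀`. -/
def chartDsymm (x₀ : M) (y : Model m) : Model m →L[ℝ] Model m :=
  mfderiv 𝓘(ℝ, Model m) (𝓡 m) (extChartAt (𝓡 m) x₀).symm y

/-- The local expression of a vector field in the chart around `x₀`. -/
def fieldInChart (X : VField m M) (x₀ : M) (y : Model m) : Model m :=
  chartD x₀ ((extChartAt (𝓡 m) x₀).symm y) (X ((extChartAt (𝓡 m) x₀).symm y))

/-- The derivative of a vector valued function in the direction of a vector field. -/
def dirDeriv {G : Type*} [NormedAddCommGroup G] [NormedSpace ℝ G] (h : M → G) (X : VField m M)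
    (y : M) : G :=
  (mfderiv (𝓡 m) 𝓘(ℝ, G) h y : Model m →L[ℝ] G) (X y)

theorem extD_swap (α : OneForm m M) (x : M) (u v : Tan m x) :
    extD α x u v = - extD α x v u := by
  have : ∀ (D : Model m →L[ℝ] Model m →L[ℝ] ℝ) (A : Model m →L[ℝ] Model m) (u v : Model m),
      (D - D.flip).bilinearComp A A u v = -(D - D.flip).bilinearComp A A v u := by
    intro D A u v
    simp
  exact this _ _ u v

theorem extD_self (α : OneForm m M) (x : M) (u : Tan m x) : extD α x u u = 0 := by
  have := extD_swap α x u u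
  linarith

variable [IsManifold (𝓡 m) ∞ M]

/-- Smoothness of a vector field at a point. -/
def SmoothFieldAt (X : VField m M) (x : M) : Prop :=
  ContMDiffAt (𝓡 m) (𝓡 m).tangent ∞
    (fun y => Bundle.TotalSpace.mk' (Model m) (E := fun z : M => TangentSpace (𝓡 m) z) y (X y)) x

/-- Smoothness of a 1-form at a point. -/
def SmoothFormAt (α : OneForm m M) (x : M) : Prop :=
  ContMDiffAt (𝓡 m) ((𝓡 m).prod 𝓘(ℝ, Model m →L[ℝ] ℝ)) ∞
    (fun x => Bundle.TotalSpace.mk' (Model m →L[ℝ] ℝ)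
      (E := fun y : M => TangentSpace (𝓡 m) y →L[ℝ] Bundle.Trivial M ℝ y) x (α x)) x

theorem SmoothFieldOn.smoothFieldAt {X : VField m M} {U : Set M} (h : SmoothFieldOn X U)
    (hU : IsOpen U) {x : M} (hx : x ∈ U) : SmoothFieldAt X x :=
  ContMDiffOn.contMDiffAt h (hU.mem_nhds hx)

theorem SmoothFormOn.smoothFormAt {α : OneForm m M} {U : Set M} (h : SmoothFormOn α U)
    (hU : IsOpen U) {x : M} (hx : x ∈ U) : SmoothFormAt α x :=
  ContMDiffOn.contMDiffAt h (hU.mem_nhds hx)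

theorem contMDiffAt_extChartAt_symm {x₀ : M} {y : Model m}
    (hy : y ∈ (extChartAt (𝓡 m) x₀).target) :
    ContMDiffAt 𝓘(ℝ, Model m) (𝓡 m) ∞ (extChartAt (𝓡 m) x₀).symm y :=
  (contMDiffOn_extChartAt_symm x₀).contMDiffAt ((isOpen_extChartAt_target x₀).mem_nhds hy)

theorem contMDiffAt_extChartAt_of_mem {x₀ z : M} (hz : z ∈ (extChartAt (𝓡 m) x₀).source) :
    ContMDiffAt (𝓡 m) 𝓘(ℝ, Model m) ∞ (extChartAt (𝓡 m) x₀) z :=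
  contMDiffAt_extChartAt' (by rwa [extChartAt_source] at hz)

theorem mdifferentiableAt_extChartAt_symm {x₀ : M} {y : Model m}
    (hy : y ∈ (extChartAt (𝓡 m) x₀).target) :
    MDifferentiableAt 𝓘(ℝ, Model m) (𝓡 m) (extChartAt (𝓡 m) x₀).symm y :=
  (contMDiffAt_extChartAt_symm hy).mdifferentiableAt (by simp)

theorem mdifferentiableAt_extChartAt_of_mem {x₀ z : M}
    (hz : z ∈ (extChartAt (𝓡 m) x₀).source) :
    MDifferentiableAt (𝓡 m) 𝓘(ℝ, Model m) (extChartAt (𝓡 m) x₀) z :=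
  (contMDiffAt_extChartAt_of_mem hz).mdifferentiableAt (by simp)

theorem chartD_chartDsymm {x₀ : M} {y : Model m} (hy : y ∈ (extChartAt (𝓡 m) x₀).target)
    (v : Model m) : chartD x₀ ((extChartAt (𝓡 m) x₀).symm y) (chartDsymm x₀ y v) = v := by
  have := mfderiv_extChartAt_comp_mfderivWithin_extChartAt_symm (I := 𝓡 m) hy
  have h2 := DFunLike.congr_fun this v
  rw [show range (𝓡 m) = univ from (𝓡 m).range_eq_univ, mfderivWithin_univ] at h2
  exact h2

theorem chartDsymm_chartD {x₀ : M} {y : Model m} (hy : y ∈ (extChartAt (𝓡 m) x₀).target)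
    (v : Model m) : chartDsymm x₀ y (chartD x₀ ((extChartAt (𝓡 m) x₀).symm y) v) = v := by
  have := mfderivWithin_extChartAt_symm_comp_mfderiv_extChartAt (I := 𝓡 m) hy
  have h2 := DFunLike.congr_fun this v
  rw [show range (𝓡 m) = univ from (𝓡 m).range_eq_univ, mfderivWithin_univ] at h2
  exact h2

theorem chartDsymm_chartD_of_mem_source {x₀ z : M} (hz : z ∈ (extChartAt (𝓡 m) x₀).source)
    (v : Model m) : chartDsymm x₀ (extChartAt (𝓡 m) x₀ z) (chartD x₀ z v) = v := by
  have := chartDsymm_chartD ((extChartAt (𝓡 m) x₀).map_source hz) v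
  rwa [(extChartAt (𝓡 m) x₀).left_inv hz] at this

theorem chartD_chartDsymm_of_mem_source {x₀ z : M} (hz : z ∈ (extChartAt (𝓡 m) x₀).source)
    (v : Model m) : chartD x₀ z (chartDsymm x₀ (extChartAt (𝓡 m) x₀ z) v) = v := by
  have := chartD_chartDsymm ((extChartAt (𝓡 m) x₀).map_source hz) v
  rwa [(extChartAt (𝓡 m) x₀).left_inv hz] at this

theorem chartD_isInvertible {x₀ z : M} (hz : z ∈ (extChartAt (𝓡 m) x₀).source) :
    (chartD (m := m) x₀ z).IsInvertible :=
  isInvertible_mfderiv_extChartAt (I := 𝓡 m) (x := x₀) hz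

theorem chartD_inverse {x₀ z : M} (hz : z ∈ (extChartAt (𝓡 m) x₀).source) :
    (chartD (m := m) x₀ z).inverse = chartDsymm x₀ (extChartAt (𝓡 m) x₀ z) := by
  refine ContinuousLinearMap.inverse_eq ?_ ?_
  · ext1 v; exact chartD_chartDsymm_of_mem_source hz v
  · ext1 v; exact chartDsymm_chartD_of_mem_source hz v

theorem chartDsymm_inverse {x₀ : M} {y : Model m} (hy : y ∈ (extChartAt (𝓡 m) x₀).target) :
    (chartDsymm (m := m) x₀ y).inverse = chartD x₀ ((extChartAt (𝓡 m) x₀).symm y) := by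
  refine ContinuousLinearMap.inverse_eq ?_ ?_
  · ext1 v; exact chartDsymm_chartD hy v
  · ext1 v; exact chartD_chartDsymm hy v

variable {G : Type*} [NormedAddCommGroup G] [NormedSpace ℝ G]

theorem fderiv_comp_extChartAt_symm {h : M → G} {x₀ : M} {y : Model m}
    (hy : y ∈ (extChartAt (𝓡 m) x₀).target)
    (hh : MDifferentiableAt (𝓡 m) 𝓘(ℝ, G) h ((extChartAt (𝓡 m) x₀).symm y)) (v : Model m) :
    fderiv ℝ (h ∘ (extChartAt (𝓡 m) x₀).symm) y v =
      (mfderiv (𝓡 m) 𝓘(ℝ, G) h ((extChartAt (𝓡 m) x₀).symm y) : Model m →L[ℝ] G)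
        (chartDsymm x₀ y v) := by
  have := mfderiv_comp y hh (mdifferentiableAt_extChartAt_symm hy)
  rw [mfderiv_eq_fderiv] at this
  exact DFunLike.congr_fun this v

/-- Directional derivatives can be computed in charts. -/
theorem dirDeriv_eq_fderiv_chart {h : M → G} {X : VField m M} {x₀ : M} {y : Model m}
    (hy : y ∈ (extChartAt (𝓡 m) x₀).target)
    (hh : MDifferentiableAt (𝓡 m) 𝓘(ℝ, G) h ((extChartAt (𝓡 m) x₀).symm y)) :
    dirDeriv h X ((extChartAt (𝓡 m) x₀).symm y) =
      fderiv ℝ (h ∘ (extChartAt (𝓡 m) x₀).symm) y (fieldInChart X x₀ y) := by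
  rw [fderiv_comp_extChartAt_symm hy hh]
  exact congrArg _ (chartDsymm_chartD hy (X ((extChartAt (𝓡 m) x₀).symm y))).symm

theorem mpullbackWithin_extChartAt_symm_eq {X : VField m M} {x₀ : M} {y : Model m}
    (hy : y ∈ (extChartAt (𝓡 m) x₀).target) :
    VectorField.mpullbackWithin 𝓘(ℝ, Model m) (𝓡 m) (extChartAt (𝓡 m) x₀).symm X (range (𝓡 m)) y
      = fieldInChart X x₀ y := by
  rw [show range (𝓡 m) = univ from (𝓡 m).range_eq_univ, VectorField.mpullbackWithin_univ,
    VectorField.mpullback_apply]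
  exact DFunLike.congr_fun (chartDsymm_inverse hy) _

theorem bracket_eq_chart (X Y : VField m M) (x : M) :
    bracket X Y x = chartDsymm x (extChartAt (𝓡 m) x x)
      (VectorField.lieBracket ℝ (fieldInChart X x) (fieldInChart Y x) (extChartAt (𝓡 m) x x)) := by
  -- The set and the pulled back fields are generalized so that `s = univ` can be substituted; the
  -- bracket depends only on the fields near the point.
  have key : ∀ (X' Y' : Model m → Model m) (s : Set (Model m)), s = univ →
      (∀ y ∈ (extChartAt (𝓡 m) x).target, X' y = fieldInChart X x y) →
      (∀ y ∈ (extChartAt (𝓡 m) x).target, Y' y = fieldInChart Y x y) →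
      (chartD x x).inverse (VectorField.lieBracketWithin ℝ X' Y' s (extChartAt (𝓡 m) x x)) =
        chartDsymm x (extChartAt (𝓡 m) x x)
          (VectorField.lieBracket ℝ (fieldInChart X x) (fieldInChart Y x)
            (extChartAt (𝓡 m) x x)) := by
    rintro X' Y' s rfl hX' hY'
    rw [VectorField.lieBracketWithin_univ, chartD_inverse (mem_extChartAt_source x)]
    have ht : (extChartAt (𝓡 m) x).target ∈ 𝓝 (extChartAt (𝓡 m) x x) :=
      extChartAt_target_mem_nhds x
    congr 1
    refine Filter.EventuallyEq.lieBracket_vectorField_eq ?_ ?_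
    · filter_upwards [ht] with y hy using hX' y hy
    · filter_upwards [ht] with y hy using hY' y hy
  exact key
    (VectorField.mpullbackWithin 𝓘(ℝ, Model m) (𝓡 m) (extChartAt (𝓡 m) x).symm X (range (𝓡 m)))
    (VectorField.mpullbackWithin 𝓘(ℝ, Model m) (𝓡 m) (extChartAt (𝓡 m) x).symm Y (range (𝓡 m)))
    ((extChartAt (𝓡 m) x).symm ⁻¹' univ ∩ range (𝓡 m))
    (by rw [(𝓡 m).range_eq_univ]; simp)
    (fun y hy => mpullbackWithin_extChartAt_symm_eq hy)
    (fun y hy => mpullbackWithin_extChartAt_symm_eq hy)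

/-- Directional derivatives of smooth functions along smooth fields are smooth. -/
theorem SmoothFieldAt.contMDiffAt_dirDeriv {X : VField m M} {x : M} {h : M → G}
    (hX : SmoothFieldAt X x) (hh : ContMDiffAt (𝓡 m) 𝓘(ℝ, G) ∞ h x) :
    ContMDiffAt (𝓡 m) 𝓘(ℝ, G) ∞ (dirDeriv h X) x := by
  have h1 := hh.mfderiv_const (m := ∞) (by simp)
  have h2 := ContMDiffAt.clm_apply_of_inCoordinates (F₁ := Model m) (F₂ := G)
    (E₁ := fun z : M => TangentSpace (𝓡 m) z) (E₂ := fun z : G => TangentSpace 𝓘(ℝ, G) z)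
    (b₁ := fun z : M => z) (b₂ := h) (v := fun z => X z)
    (ϕ := fun z => mfderiv (𝓡 m) 𝓘(ℝ, G) h z) h1 hX hh
  have h3 := (Bundle.contMDiffAt_totalSpace.1 h2).2
  simpa using! h3

end Charts

/-! ### Smooth fields and forms, and the invariant formula for `dα` -/

section

open Function

section VectorCalculus

variable {m : ℕ} {M : Type*} [TopologicalSpace M] [ChartedSpace (Model m) M]
  [IsManifold (𝓡 m) ∞ M] {G : Type*} [NormedAddCommGroup G] [NormedSpace ℝ G]

theorem contDiffAt_comp_extChartAt_symm {h : M → G} {x₀ : M} {y : Model m}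
    (hy : y ∈ (extChartAt (𝓡 m) x₀).target)
    (hh : ContMDiffAt (𝓡 m) 𝓘(ℝ, G) ∞ h ((extChartAt (𝓡 m) x₀).symm y)) :
    ContDiffAt ℝ ∞ (h ∘ (extChartAt (𝓡 m) x₀).symm) y :=
  contMDiffAt_iff_contDiffAt.1 (hh.comp y (contMDiffAt_extChartAt_symm hy))

/-- The local expression of `X` is the derivative of the chart map along `X`, read in the chart. -/
theorem SmoothFieldAt.contDiffAt_fieldInChart {X : VField m M} {x₀ : M} {y : Model m}
    (hy : y ∈ (extChartAt (𝓡 m) x₀).target)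
    (hX : SmoothFieldAt X ((extChartAt (𝓡 m) x₀).symm y)) :
    ContDiffAt ℝ ∞ (fieldInChart X x₀) y :=
  contDiffAt_comp_extChartAt_symm (h := dirDeriv (extChartAt (𝓡 m) x₀) X) hy
    (hX.contMDiffAt_dirDeriv
      (contMDiffAt_extChartAt_of_mem ((extChartAt (𝓡 m) x₀).map_target hy)))

/-- The commutator acts on functions as the commutator of directional derivatives. -/
theorem dirDeriv_bracket {X Y : VField m M} {x : M} {h : M → G}
    (hX : SmoothFieldAt X x) (hY : SmoothFieldAt Y x) (hh : ContMDiffAt (𝓡 m) 𝓘(ℝ, G) ∞ h x) :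
    dirDeriv h (bracket X Y) x =
      dirDeriv (dirDeriv h Y) X x - dirDeriv (dirDeriv h X) Y x := by
  set φ := extChartAt (𝓡 m) x with hφ
  have he : φ x ∈ φ.target := mem_extChartAt_target x
  have hx : φ.symm (φ x) = x := extChartAt_to_inv x
  have hX' : SmoothFieldAt X (φ.symm (φ x)) := by rwa [hx]
  have hY' : SmoothFieldAt Y (φ.symm (φ x)) := by rwa [hx]
  have hh' : ContMDiffAt (𝓡 m) 𝓘(ℝ, G) ∞ h (φ.symm (φ x)) := by rwa [hx]
  have hdX := hX.contMDiffAt_dirDeriv hh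
  have hdY := hY.contMDiffAt_dirDeriv hh
  have hev : ∀ Z : VField m M, dirDeriv h Z ∘ φ.symm =ᶠ[𝓝 (φ x)]
      fun y => fderiv ℝ (h ∘ φ.symm) y (fieldInChart Z x y) := by
    intro Z
    have h1 : ∀ᶠ z in 𝓝 (φ.symm (φ x)), MDifferentiableAt (𝓡 m) 𝓘(ℝ, G) h z := by
      have h0 : ContMDiffAt (𝓡 m) 𝓘(ℝ, G) 1 h (φ.symm (φ x)) := hh'.of_le (by simp)
      filter_upwards [(contMDiffAt_iff_contMDiffAt_nhds (by simp)).1 h0] with z hz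
      exact hz.mdifferentiableAt (by simp)
    have h2 := (continuousAt_extChartAt_symm'' he).eventually h1
    filter_upwards [h2, extChartAt_target_mem_nhds x] with y hy hyt
    exact dirDeriv_eq_fderiv_chart hyt hy
  have e1 : dirDeriv (dirDeriv h Y) X x = fderiv ℝ
      (fun y => fderiv ℝ (h ∘ φ.symm) y (fieldInChart Y x y)) (φ x) (fieldInChart X x (φ x)) := by
    rw [← (hev Y).fderiv_eq, ← dirDeriv_eq_fderiv_chart he, hx]
    rw [hx]; exact hdY.mdifferentiableAt (by simp)
  have e2 : dirDeriv (dirDeriv h X) Y x = fderiv ℝ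
      (fun y => fderiv ℝ (h ∘ φ.symm) y (fieldInChart X x y)) (φ x) (fieldInChart Y x (φ x)) := by
    rw [← (hev X).fderiv_eq, ← dirDeriv_eq_fderiv_chart he, hx]
    rw [hx]; exact hdX.mdifferentiableAt (by simp)
  have e3 : dirDeriv h (bracket X Y) x = fderiv ℝ (h ∘ φ.symm) (φ x)
      (VectorField.lieBracket ℝ (fieldInChart X x) (fieldInChart Y x) (φ x)) := by
    rw [fderiv_comp_extChartAt_symm he (hh'.mdifferentiableAt (by simp)), dirDeriv,
      bracket_eq_chart, hx]
  rw [e1, e2, e3]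
  exact VectorField.fderiv_apply_lieBracket (n := ∞)
    (contDiffAt_comp_extChartAt_symm he hh')
    (by rw [minSmoothness_of_isRCLikeNormedField]; exact ENat.LEInfty.out)
    ((hY'.contDiffAt_fieldInChart he).differentiableAt (by simp))
    ((hX'.contDiffAt_fieldInChart he).differentiableAt (by simp))

/-- The vector field with constant coefficients in the chart around `x₀`. -/
def coordField (x₀ : M) (v : Model m) : VField m M := fun z =>
  chartDsymm x₀ (extChartAt (𝓡 m) x₀ z) v

/-- On the chart domain this is the pullback of a constant field. -/
theorem smoothFieldAt_coordField {x₀ z : M} (hz : z ∈ (extChartAt (𝓡 m) x₀).source)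
    (v : Model m) : SmoothFieldAt (coordField x₀ v) z := by
  have h1 : ContMDiffAt 𝓘(ℝ, Model m) 𝓘(ℝ, Model m).tangent ∞
      (fun y => Bundle.TotalSpace.mk' (Model m)
        (E := fun z : Model m => TangentSpace 𝓘(ℝ, Model m) z) y v) (extChartAt (𝓡 m) x₀ z) :=
    contMDiffAt_vectorSpace_iff_contDiffAt.2 contDiffAt_const
  have h2 := ContMDiffAt.mpullback_vectorField_preimage (n := ∞) h1
    (contMDiffAt_extChartAt_of_mem hz) (chartD_isInvertible hz) (by simp)
  refine h2.congr_of_eventuallyEq ?_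
  filter_upwards [(isOpen_extChartAt_source x₀).mem_nhds hz] with w hw
  have := DFunLike.congr_fun (chartD_inverse hw) v
  exact congrArg (Bundle.TotalSpace.mk' (Model m)
    (E := fun z : M => TangentSpace (𝓡 m) z) w) this.symm

/-- Extending tangent vectors to fields makes pointwise identities for `extD` and `lieD` accessible
to the formulas with brackets. -/
theorem exists_smoothField_eq (x : M) (v : Tan m x) :
    ∃ X : VField m M, X x = v ∧ ∀ᶠ y in 𝓝 x, SmoothFieldAt X y := by
  refine ⟨coordField x (chartD (m := m) x x v),
    chartDsymm_chartD_of_mem_source (mem_extChartAt_source x) v, ?_⟩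
  filter_upwards [extChartAt_source_mem_nhds (I := 𝓡 m) x] with y hy
  exact smoothFieldAt_coordField hy _

theorem SmoothFormAt.contMDiffAt_apply {α : OneForm m M} {X : VField m M} {x : M}
    (hα : SmoothFormAt α x) (hX : SmoothFieldAt X x) :
    ContMDiffAt (𝓡 m) 𝓘(ℝ, ℝ) ∞ (fun y => α y (X y)) x := by
  have h := ContMDiffAt.clm_bundle_apply (F₁ := Model m) (F₂ := ℝ)
    (E₁ := fun z : M => TangentSpace (𝓡 m) z) (E₂ := Bundle.Trivial M ℝ) hα hX
  exact (Bundle.contMDiffAt_section x).1 h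

theorem contDiffAt_clm_of_apply {D V : Type*} [NormedAddCommGroup D] [NormedSpace ℝ D]
    [NormedAddCommGroup V] [NormedSpace ℝ V] [FiniteDimensional ℝ V] {k : ℕ∞ω}
    {f : D → V →L[ℝ] G} {x : D} (h : ∀ v, ContDiffAt ℝ k (fun y => f y v) x) :
    ContDiffAt ℝ k f x := by
  let d := Module.finrank ℝ V
  have hd : d = Module.finrank ℝ (Fin d → ℝ) := (Module.finrank_fin_fun ℝ).symm
  let e₁ := ContinuousLinearEquiv.ofFinrankEq hd
  let e₂ := (e₁.arrowCongr (1 : G ≃L[ℝ] G)).trans (ContinuousLinearEquiv.piRing (Fin d))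
  rw [← id_comp f, ← e₂.symm_comp_self]
  exact e₂.symm.contDiff.contDiffAt.comp x (contDiffAt_pi.mpr fun i => h _)

theorem SmoothFormAt.contDiffAt_localExpr {α : OneForm m M} {x : M}
    (hα : SmoothFormAt α x) : ContDiffAt ℝ ∞ (localExpr α x) (extChartAt (𝓡 m) x x) := by
  refine contDiffAt_clm_of_apply fun v => ?_
  have h1 := hα.contMDiffAt_apply (smoothFieldAt_coordField (mem_extChartAt_source x) v)
  have h2 : ContMDiffAt (𝓡 m) 𝓘(ℝ, ℝ) ∞ (fun y => α y (coordField x v y))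
      ((extChartAt (𝓡 m) x).symm (extChartAt (𝓡 m) x x)) := by
    rw [extChartAt_to_inv]; exact h1
  refine (contDiffAt_comp_extChartAt_symm (mem_extChartAt_target (I := 𝓡 m) x)
    h2).congr_of_eventuallyEq ?_
  filter_upwards [extChartAt_target_mem_nhds (I := 𝓡 m) x] with y hy
  exact congrArg (fun w => (α ((extChartAt (𝓡 m) x).symm y) : Model m →L[ℝ] ℝ) (chartDsymm x w v))
    ((extChartAt (𝓡 m) x).right_inv hy).symm

theorem SmoothFieldAt.bracket {X Y : VField m M} {x : M}
    (hX : SmoothFieldAt X x) (hY : SmoothFieldAt Y x) : SmoothFieldAt (bracket X Y) x := by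
  have h1 : IsManifold (𝓡 m) (minSmoothness ℝ 2) M := by
    rw [minSmoothness_of_isRCLikeNormedField]; infer_instance
  have h2 : IsManifold (𝓡 m) (((⊤ : ℕ∞) : ℕ∞ω) + 1) M := by simpa using! ‹IsManifold (𝓡 m) ∞ M›
  exact ContMDiffAt.mlieBracket_vectorField (m := ⊤) (n := ⊤) hX hY (by simp)

theorem bracket_bracket {X Y Z : VField m M} {x : M}
    (hX : SmoothFieldAt X x) (hY : SmoothFieldAt Y x) (hZ : SmoothFieldAt Z x) :
    ContactGeometry.bracket X (ContactGeometry.bracket Y Z) x =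
      ContactGeometry.bracket (ContactGeometry.bracket X Y) Z x +
        ContactGeometry.bracket Y (ContactGeometry.bracket X Z) x := by
  have : IsManifold (𝓡 m) (minSmoothness ℝ 3) M := by
    rw [minSmoothness_of_isRCLikeNormedField]; infer_instance
  have h2 : minSmoothness ℝ 2 ≤ ∞ := by
    rw [minSmoothness_of_isRCLikeNormedField]; exact ENat.LEInfty.out
  exact VectorField.leibniz_identity_mlieBracket_apply (hX.of_le h2) (hY.of_le h2) (hZ.of_le h2)

/-- The invariant formula for the exterior derivative of a 1-form. -/
theorem extD_apply {α : OneForm m M} {X Y : VField m M} {x : M}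
    (hα : SmoothFormAt α x) (hX : SmoothFieldAt X x) (hY : SmoothFieldAt Y x) :
    extD α x (X x) (Y x) = dirDeriv (fun y => α y (Y y)) X x - dirDeriv (fun y => α y (X y)) Y x -
      α x (ContactGeometry.bracket X Y x) := by
  set φ := extChartAt (𝓡 m) x with hφ
  have he : φ x ∈ φ.target := mem_extChartAt_target x
  have hx : φ.symm (φ x) = x := extChartAt_to_inv x
  have hX' : SmoothFieldAt X (φ.symm (φ x)) := by rwa [hx]
  have hY' : SmoothFieldAt Y (φ.symm (φ x)) := by rwa [hx]
  have hX'' : DifferentiableAt ℝ (fieldInChart X x) (φ x) :=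
    (hX'.contDiffAt_fieldInChart he).differentiableAt (by simp)
  have hY'' : DifferentiableAt ℝ (fieldInChart Y x) (φ x) :=
    (hY'.contDiffAt_fieldInChart he).differentiableAt (by simp)
  have hα' : DifferentiableAt ℝ (localExpr α x) (φ x) :=
    hα.contDiffAt_localExpr.differentiableAt (by simp)
  have hev : ∀ Z : VField m M, (fun y => α y (Z y)) ∘ φ.symm =ᶠ[𝓝 (φ x)]
      fun y => localExpr α x y (fieldInChart Z x y) := by
    intro Z
    filter_upwards [extChartAt_target_mem_nhds x] with y hyt
    exact congrArg (α (φ.symm y)) (chartDsymm_chartD hyt (Z (φ.symm y))).symm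
  have hfc : ∀ Z : VField m M, fieldInChart Z x (φ x) = chartD x x (Z x) := by
    intro Z; rw [fieldInChart, hx]
  have e : ∀ {Z Z' : VField m M}, SmoothFieldAt Z x →
      DifferentiableAt ℝ (fieldInChart Z x) (φ x) →
      dirDeriv (fun y => α y (Z y)) Z' x =
        fderiv ℝ (localExpr α x) (φ x) (fieldInChart Z' x (φ x)) (fieldInChart Z x (φ x)) +
        localExpr α x (φ x) (fderiv ℝ (fieldInChart Z x) (φ x) (fieldInChart Z' x (φ x))) := by
    intro Z Z' hZ hZ'
    have h1 : dirDeriv (fun y => α y (Z y)) Z' x = fderiv ℝ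
        (fun y => localExpr α x y (fieldInChart Z x y)) (φ x) (fieldInChart Z' x (φ x)) := by
      rw [← (hev Z).fderiv_eq, ← dirDeriv_eq_fderiv_chart he, hx]
      rw [hx]; exact (hα.contMDiffAt_apply hZ).mdifferentiableAt (by simp)
    rw [h1, fderiv_clm_apply hα' hZ']
    simp [add_comm]
  have hb : α x (ContactGeometry.bracket X Y x) = localExpr α x (φ x)
      (VectorField.lieBracket ℝ (fieldInChart X x) (fieldInChart Y x) (φ x)) := by
    rw [bracket_eq_chart]
    have : ∀ z, z = x → ∀ v : Model m, α x v = (α z : Model m →L[ℝ] ℝ) v := by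
      rintro z rfl v; rfl
    exact this _ hx _
  have hd : extD α x (X x) (Y x) =
      fderiv ℝ (localExpr α x) (φ x) (fieldInChart X x (φ x)) (fieldInChart Y x (φ x)) -
      fderiv ℝ (localExpr α x) (φ x) (fieldInChart Y x (φ x)) (fieldInChart X x (φ x)) := by
    rw [hfc, hfc]; rfl
  rw [hd, e hX hX'', e hY hY'', hb, VectorField.lieBracket_eq]
  simp only [map_sub]
  ring

end VectorCalculus

end

/-! ### Locally constant properties on an interval -/

section Intervals

/-- Connectedness of the interval. The propagation statements along integral curves reduce to this,
so that differential equations are only solved inside one chart. -/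
theorem iff_of_eventually_iff {Q : ℝ → Prop} {a b : ℝ}
    (h : ∀ t ∈ Icc a b, ∀ᶠ s in 𝓝[Icc a b] t, (Q t ↔ Q s)) {s t : ℝ} (hs : s ∈ Icc a b)
    (ht : t ∈ Icc a b) : Q s ↔ Q t :=
  isPreconnected_Icc.induction₂ (fun s t => (Q s ↔ Q t)) h
    (fun _ _ _ _ _ _ => Iff.trans) (fun _ _ _ _ => Iff.symm) hs ht

theorem eventually_forall_uIcc {R : ℝ → Prop} {a b t : ℝ} (ht : t ∈ Icc a b)
    (h : ∀ᶠ s in 𝓝[Icc a b] t, R s) :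
    ∀ᶠ s in 𝓝[Icc a b] t, uIcc t s ⊆ Icc a b ∧ ∀ u ∈ uIcc t s, R u := by
  rw [eventually_nhdsWithin_iff, Metric.eventually_nhds_iff] at h
  obtain ⟨δ, hδ, h⟩ := h
  rw [eventually_nhdsWithin_iff, Metric.eventually_nhds_iff]
  refine ⟨δ, hδ, fun s hs hsI => ⟨ordConnected_Icc.uIcc_subset ht hsI, fun u hu => h ?_
    (ordConnected_Icc.uIcc_subset ht hsI hu)⟩⟩
  rw [Real.dist_eq] at hs ⊢
  exact (abs_sub_left_of_mem_uIcc hu).trans_lt hs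

/-- Uniqueness for the linear equation on the interval between `t` and `s`, applied from either end.
-/
theorem eventually_eq_zero_iff {G : Type*} [NormedAddCommGroup G] [NormedSpace ℝ G]
    {w : ℝ → G} {L : ℝ → G →L[ℝ] G} {K : ℝ≥0} {a b t : ℝ} (ht : t ∈ Icc a b)
    (h : ∀ᶠ s in 𝓝[Icc a b] t, ‖L s‖ ≤ K ∧ HasDerivWithinAt w (L s (w s)) (Icc a b) s) :
    ∀ᶠ s in 𝓝[Icc a b] t, (w t = 0 ↔ w s = 0) := by
  filter_upwards [eventually_forall_uIcc ht h] with s hs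
  have hz := fun t₀ (ht₀ : t₀ ∈ uIcc t s) h0 => linear_ode_eq_zero (a := min t s) (b := max t s)
    (fun u hu => (hs.2 u hu).1) (fun u hu => (hs.2 u hu).2.mono hs.1) (t₀ := t₀) ht₀ h0
  exact ⟨fun h => hz t left_mem_uIcc h s right_mem_uIcc,
    fun h => hz s right_mem_uIcc h t left_mem_uIcc⟩

end Intervals

/-! ### Integral curves on the manifold -/

section Curves

variable {m : ℕ} {M : Type*} [TopologicalSpace M] [ChartedSpace (Model m) M]

theorem hasDerivWithinAt_comp_curve {G : Type*} [NormedAddCommGroup G] [NormedSpace ℝ G]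
    {γ : ℝ → M} {X : VField m M} {s : Set ℝ} {t : ℝ} {h : M → G}
    (hγ : IsMIntegralCurveOn (I := 𝓡 m) γ X s) (ht : t ∈ s)
    (hh : MDifferentiableAt (𝓡 m) 𝓘(ℝ, G) h (γ t)) :
    HasDerivWithinAt (fun u => h (γ u)) (dirDeriv h X (γ t)) s t := by
  have key : ∀ (A : Model m →L[ℝ] G) (v : Model m),
      HasFDerivWithinAt (fun u => h (γ u)) (A.comp ((1 : ℝ →L[ℝ] ℝ).smulRight v)) s t →
      HasDerivWithinAt (fun u => h (γ u)) (A v) s t := by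
    intro A v hA
    exact hA.hasDerivWithinAt.congr_deriv (by simp)
  exact key _ _ (hasMFDerivWithinAt_iff_hasFDerivWithinAt.1
    (hh.hasMFDerivAt.comp_hasMFDerivWithinAt t (hγ t ht)))

theorem continuousWithinAt_curve {γ : ℝ → M} {X : VField m M} {s : Set ℝ} {t : ℝ}
    (hγ : IsMIntegralCurveOn (I := 𝓡 m) γ X s) (ht : t ∈ s) : ContinuousWithinAt γ s t :=
  (hγ t ht).continuousWithinAt

theorem fieldInChart_extChartAt {X : VField m M} {x₀ z : M}
    (hz : z ∈ (extChartAt (𝓡 m) x₀).source) :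
    fieldInChart X x₀ (extChartAt (𝓡 m) x₀ z) = chartD x₀ z (X z) := by
  rw [fieldInChart, (extChartAt (𝓡 m) x₀).left_inv hz]

variable [IsManifold (𝓡 m) ∞ M]

theorem hasDerivWithinAt_extChartAt_curve {γ : ℝ → M} {X : VField m M} {s : Set ℝ} {t : ℝ}
    {x₀ : M} (hγ : IsMIntegralCurveOn (I := 𝓡 m) γ X s) (ht : t ∈ s)
    (hx : γ t ∈ (extChartAt (𝓡 m) x₀).source) :
    HasDerivWithinAt (fun u => extChartAt (𝓡 m) x₀ (γ u))
      (fieldInChart X x₀ (extChartAt (𝓡 m) x₀ (γ t))) s t := by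
  rw [fieldInChart_extChartAt hx]
  exact hasDerivWithinAt_comp_curve hγ ht (mdifferentiableAt_extChartAt_of_mem hx)

/-- Integral curves of a smooth vector field on a compact interval are determined by one value. -/
theorem eqOn_of_isMIntegralCurveOn [T2Space M] {γ₁ γ₂ : ℝ → M} {X : VField m M} {a b : ℝ}
    (hX : ∀ x, SmoothFieldAt X x)
    (h₁ : IsMIntegralCurveOn (I := 𝓡 m) γ₁ X (Icc a b))
    (h₂ : IsMIntegralCurveOn (I := 𝓡 m) γ₂ X (Icc a b)) {t₀ : ℝ} (ht₀ : t₀ ∈ Icc a b)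
    (h0 : γ₁ t₀ = γ₂ t₀) : EqOn γ₁ γ₂ (Icc a b) := by
  refine fun t ht => (iff_of_eventually_iff (Q := fun t => γ₁ t = γ₂ t) ?_ ht₀ ht).1 h0
  clear! t t₀
  intro t ht
  have c₁ := continuousWithinAt_curve h₁ ht
  have c₂ := continuousWithinAt_curve h₂ ht
  by_cases heq : γ₁ t = γ₂ t
  swap
  -- Distinct points stay distinct nearby because the diagonal of a Hausdorff space is closed.
  · filter_upwards [(c₁.prodMk c₂).tendsto.eventually
      (isClosed_diagonal.isOpen_compl.mem_nhds (show (γ₁ t, γ₂ t) ∉ diagonal M from heq))] with s hs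
    exact iff_of_false heq hs
  set φ := extChartAt (𝓡 m) (γ₁ t) with hφ
  have hp : γ₁ t ∈ φ.source := mem_extChartAt_source _
  have hsm : ContDiffAt ℝ 1 (fieldInChart X (γ₁ t)) (φ (γ₁ t)) :=
    ((hX _).contDiffAt_fieldInChart (φ.map_source hp)).of_le (by simp)
  obtain ⟨K, S, hS, hK⟩ := hsm.exists_lipschitzOnWith
  have hnear : ∀ᶠ z in 𝓝 (γ₁ t), z ∈ φ.source ∧ φ z ∈ S :=
    (show ∀ᶠ z in 𝓝 (γ₁ t), z ∈ φ.source from extChartAt_source_mem_nhds _).and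
      ((continuousAt_extChartAt _).eventually hS)
  have hR : ∀ᶠ s in 𝓝[Icc a b] t, (γ₁ s ∈ φ.source ∧ φ (γ₁ s) ∈ S) ∧
      (γ₂ s ∈ φ.source ∧ φ (γ₂ s) ∈ S) :=
    (c₁.eventually hnear).and (c₂.eventually (by rwa [← heq]))
  filter_upwards [eventually_forall_uIcc ht hR] with s hs
  refine iff_of_true heq ?_
  have := ode_eqOn_of_eq (v := fun _ => fieldInChart X (γ₁ t)) (S := fun _ => S) (K := K)
    (f := fun u => φ (γ₁ u)) (g := fun u => φ (γ₂ u)) (a := min t s) (b := max t s) (t₀ := t)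
    (fun _ _ => hK)
    (fun u hu => (hasDerivWithinAt_extChartAt_curve h₁ (hs.1 hu) (hs.2 u hu).1.1).mono hs.1)
    (fun u hu => (hs.2 u hu).1.2)
    (fun u hu => (hasDerivWithinAt_extChartAt_curve h₂ (hs.1 hu) (hs.2 u hu).2.1).mono hs.1)
    (fun u hu => (hs.2 u hu).2.2) left_mem_uIcc (by simp only [heq])
  exact φ.injOn (hs.2 s right_mem_uIcc).1.1 (hs.2 s right_mem_uIcc).2.1 (this right_mem_uIcc)

theorem dirDeriv_comm_of_bracket_eq_zero {G : Type*} [NormedAddCommGroup G] [NormedSpace ℝ G]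
    {X Y : VField m M} {x : M} {h : M → G}
    (hX : SmoothFieldAt X x) (hY : SmoothFieldAt Y x) (hh : ContMDiffAt (𝓡 m) 𝓘(ℝ, G) ∞ h x)
    (hb : bracket X Y x = 0) : dirDeriv (dirDeriv h Y) X x = dirDeriv (dirDeriv h X) Y x := by
  have h1 := dirDeriv_bracket hX hY hh
  rw [dirDeriv, hb] at h1
  have h2 : (mfderiv (𝓡 m) 𝓘(ℝ, G) h x : Model m →L[ℝ] G) (0 : Model m) = 0 := map_zero _
  exact sub_eq_zero.1 (h1.symm.trans h2)

/-- A vector field vanishing at a point of an integral curve of a commuting vector field vanishes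
along this curve. -/
theorem eq_zero_iff_of_isMIntegralCurveOn {γ : ℝ → M} {X Y : VField m M} {a b : ℝ}
    (hX : ∀ x, SmoothFieldAt X x) (hY : ∀ x, SmoothFieldAt Y x) (hXY : ∀ x, bracket X Y x = 0)
    (hγ : IsMIntegralCurveOn (I := 𝓡 m) γ Y (Icc a b)) {s t : ℝ} (hs : s ∈ Icc a b)
    (ht : t ∈ Icc a b) : X (γ s) = 0 ↔ X (γ t) = 0 := by
  refine iff_of_eventually_iff (Q := fun t => X (γ t) = 0) ?_ hs ht
  clear! s t
  intro t ht
  have c := continuousWithinAt_curve hγ ht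
  set φ := extChartAt (𝓡 m) (γ t) with hφ
  have hp : γ t ∈ φ.source := mem_extChartAt_source _
  have hsm : ContDiffAt ℝ ∞ (fieldInChart Y (γ t)) (φ (γ t)) :=
    (hY _).contDiffAt_fieldInChart (φ.map_source hp)
  set K : ℝ≥0 := ‖fderiv ℝ (fieldInChart Y (γ t)) (φ (γ t))‖₊ + 1 with hK
  have hbd : ∀ᶠ y in 𝓝 (φ (γ t)), ‖fderiv ℝ (fieldInChart Y (γ t)) y‖ < K :=
    (hsm.fderiv_right (m := 0) (by simp)).continuousAt.norm.eventually_lt continuousAt_const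
      (by simp [hK])
  have hnear : ∀ᶠ z in 𝓝 (γ t), z ∈ φ.source ∧ ‖fderiv ℝ (fieldInChart Y (γ t)) (φ z)‖ < K :=
    (show ∀ᶠ z in 𝓝 (γ t), z ∈ φ.source from extChartAt_source_mem_nhds _).and
      ((continuousAt_extChartAt _).eventually hbd)
  -- As `X` and `Y` commute, the derivative along `Y` of the components of `X` is the derivative of
  -- the components of `Y` in the direction `X`. Along a curve of `Y` the components of `X` hence
  -- solve a linear equation.
  have hd : ∀ z ∈ φ.source, dirDeriv (dirDeriv φ X) Y z =
      fderiv ℝ (fieldInChart Y (γ t)) (φ z) (dirDeriv φ X z) := by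
    intro z hz
    have hz' : ContMDiffAt (𝓡 m) 𝓘(ℝ, Model m) ∞ φ z := contMDiffAt_extChartAt_of_mem hz
    rw [← dirDeriv_comm_of_bracket_eq_zero (hX z) (hY z) hz' (hXY z)]
    have h1 := dirDeriv_eq_fderiv_chart (h := dirDeriv φ Y) (X := X) (x₀ := γ t)
      (φ.map_source hz) (by
        rw [φ.left_inv hz]
        exact ((hY z).contMDiffAt_dirDeriv hz').mdifferentiableAt (by simp))
    rw [φ.left_inv hz, fieldInChart_extChartAt hz] at h1
    exact h1
  have hL : ∀ᶠ s in 𝓝[Icc a b] t, ‖fderiv ℝ (fieldInChart Y (γ t)) (φ (γ s))‖ ≤ K ∧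
      HasDerivWithinAt (fun s => dirDeriv φ X (γ s))
        (fderiv ℝ (fieldInChart Y (γ t)) (φ (γ s)) (dirDeriv φ X (γ s))) (Icc a b) s := by
    filter_upwards [c.eventually hnear, self_mem_nhdsWithin] with s hs hsI
    refine ⟨hs.2.le, ?_⟩
    rw [← hd _ hs.1]
    exact hasDerivWithinAt_comp_curve hγ hsI (((hX _).contMDiffAt_dirDeriv
      (contMDiffAt_extChartAt_of_mem hs.1)).mdifferentiableAt (by simp))
  have hiff : ∀ z ∈ φ.source, dirDeriv φ X z = 0 ↔ X z = 0 := by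
    intro z hz
    constructor
    · intro h
      have h1 := chartDsymm_chartD_of_mem_source hz (X z)
      have h2 : chartD (γ t) z (X z) = 0 := h
      rw [h2, map_zero] at h1
      exact h1.symm
    · intro h
      rw [dirDeriv, h]
      exact map_zero (mfderiv (𝓡 m) 𝓘(ℝ, Model m) φ z : Model m →L[ℝ] Model m)
  filter_upwards [eventually_eq_zero_iff ht hL, c.eventually hnear] with s hs hs'
  rw [← hiff _ hp, ← hiff _ hs'.1]
  exact hs

end Curves

/-! ### Propagation along orbits -/

section Orbits

variable {m : ℕ} {M : Type*} [TopologicalSpace M] [ChartedSpace (Model m) M]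

theorem mem_orbit_of_isMIntegralCurveOn {𝒳 : Submodule ℝ (VField m M)} {X : VField m M}
    (hX : X ∈ 𝒳) {γ : ℝ → M} {a b t : ℝ} {x : M}
    (hγ : IsMIntegralCurveOn (I := 𝓡 m) γ X (Icc a b)) (ht : t ∈ Icc a b)
    (hx : γ a ∈ orbit 𝒳 x) : γ t ∈ orbit 𝒳 x :=
  Relation.ReflTransGen.tail hx
    ⟨X, hX, γ, a, t, ht.1, hγ.mono (Icc_subset_Icc_right ht.2), rfl, rfl⟩

/-- A property which is locally constant along integral curves is constant along orbits. -/
theorem iff_of_mem_orbit {𝒳 : Submodule ℝ (VField m M)} {Q : M → Prop}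
    (h : ∀ X ∈ 𝒳, ∀ (γ : ℝ → M) (a b : ℝ), IsMIntegralCurveOn (I := 𝓡 m) γ X (Icc a b) →
      ∀ t ∈ Icc a b, ∀ᶠ s in 𝓝[Icc a b] t, (Q (γ t) ↔ Q (γ s)))
    {x y : M} (hy : y ∈ orbit 𝒳 x) : Q x ↔ Q y := by
  induction hy with
  | refl => rfl
  | tail _ hs ih =>
    obtain ⟨X, hX, γ, a, b, hab, hγ, rfl, rfl⟩ := hs
    exact ih.trans (iff_of_eventually_iff (Q := fun t => Q (γ t)) (h X hX γ a b hγ)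
      ⟨le_rfl, hab⟩ ⟨hab, le_rfl⟩)

/-- Applied to differences, this propagates a linear relation among values of `𝒳` from one point to
its orbit: fields that realize all values at one point do so along the orbit. -/
theorem eq_zero_iff_of_mem_orbit [IsManifold (𝓡 m) ∞ M] {𝒳 : Submodule ℝ (VField m M)}
    (hs : ∀ X ∈ 𝒳, ∀ x, SmoothFieldAt X x) (hab : ∀ X ∈ 𝒳, ∀ Y ∈ 𝒳, ∀ x, bracket X Y x = 0)
    {X : VField m M} (hX : X ∈ 𝒳) {x y : M} (hy : y ∈ orbit 𝒳 x) : X x = 0 ↔ X y = 0 := by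
  induction hy with
  | refl => rfl
  | tail _ hs' ih =>
    obtain ⟨Y, hY, γ, a, b, hab', hγ, rfl, rfl⟩ := hs'
    exact ih.trans (eq_zero_iff_of_isMIntegralCurveOn (hs X hX) (hs Y hY) (hab X hX Y hY) hγ
      ⟨le_rfl, hab'⟩ ⟨hab', le_rfl⟩)

end Orbits

/-! ### Local actions of commuting families and countable covers of orbits -/

section Plaques

variable {m : ℕ} {M : Type*} [TopologicalSpace M] [ChartedSpace (Model m) M]
  {P : Type*} [NormedAddCommGroup P] [NormedSpace ℝ P] [FiniteDimensional ℝ P]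

/-- The evaluation at `x` of a linear family of vector fields. -/
def evalField (ℓ : P →ₗ[ℝ] VField m M) (x : M) : P →L[ℝ] Model m :=
  LinearMap.toContinuousLinearMap
    { toFun := fun b => ℓ b x
      map_add' := fun a b => by rw [map_add]; rfl
      map_smul' := fun c b => by rw [map_smul]; rfl }

/-- `Φ` is a local action of the linear family `ℓ` of vector fields, defined on the ball of
radius `ε`. -/
def IsPlaque (ℓ : P →ₗ[ℝ] VField m M) (ε : ℝ) (Φ : P → M) : Prop :=
  ∀ a ∈ ball (0 : P) ε, HasMFDerivAt 𝓘(ℝ, P) (𝓡 m) Φ a (evalField (P := P) ℓ (Φ a))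

theorem IsPlaque.continuousAt {ℓ : P →ₗ[ℝ] VField m M} {ε : ℝ} {Φ : P → M}
    (h : IsPlaque ℓ ε Φ) {a : P} (ha : a ∈ ball (0 : P) ε) : ContinuousAt Φ a :=
  (h a ha).continuousAt

/-- By the chain rule, straight lines in the parameter space are mapped to integral curves. -/
theorem IsPlaque.isMIntegralCurveOn {ℓ : P →ₗ[ℝ] VField m M} {ε : ℝ} {Φ : P → M}
    (h : IsPlaque ℓ ε Φ) {a b : P} {s : Set ℝ} (hs : ∀ t ∈ s, a + t • b ∈ ball (0 : P) ε) :
    IsMIntegralCurveOn (I := 𝓡 m) (fun t => Φ (a + t • b)) (ℓ b) s := by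
  intro t ht
  have h1 : HasDerivAt (fun t : ℝ => a + t • b) b t := by
    simpa using ((hasDerivAt_id t).smul_const b).const_add a
  have h2 := ((h _ (hs t ht)).comp t h1.hasFDerivAt.hasMFDerivAt).hasMFDerivWithinAt (s := s)
  have h3 : (evalField ℓ (Φ (a + t • b))).comp (ContinuousLinearMap.toSpanSingleton ℝ b) =
      (1 : ℝ →L[ℝ] ℝ).smulRight (ℓ b (Φ (a + t • b)) : Model m) := by
    have h4 : ∀ v : Model m, v = (1 : ℝ →L[ℝ] ℝ).smulRight v 1 := fun v => by simp
    ext1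
    rw [ContinuousLinearMap.comp_apply, ContinuousLinearMap.toSpanSingleton_apply, one_smul]
    exact h4 _
  exact h3 ▸ h2

variable [IsManifold (𝓡 m) ∞ M]

/-- In a chart a plaque solves `dΦ = Θ(Φ)`, with `Θ` the local expression of the family, and
vanishing brackets are the integrability condition. The radius is uniform near `p`, which the
countable covering argument requires. -/
theorem exists_isPlaque {ℓ : P →ₗ[ℝ] VField m M} (hs : ∀ b x, SmoothFieldAt (ℓ b) x)
    (hab : ∀ a b x, bracket (ℓ a) (ℓ b) x = 0) (p : M) :
    ∃ ε > 0, ∃ N : Set M, IsOpen N ∧ p ∈ N ∧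
      ∀ y ∈ N, ∃ Φ : P → M, Φ 0 = y ∧ IsPlaque ℓ ε Φ := by
  set φ := extChartAt (𝓡 m) p with hφ
  let Θ : Model m → P →L[ℝ] Model m := fun y =>
    (chartD p (φ.symm y)).comp (evalField ℓ (φ.symm y))
  have hΘ : ∀ y b, Θ y b = fieldInChart (ℓ b) p y := fun _ _ => rfl
  have hcd : ∀ y ∈ φ.target, ContDiffAt ℝ ∞ Θ y := fun y hy =>
    contDiffAt_clm_of_apply fun b => (hs b _).contDiffAt_fieldInChart hy
  have hfd : ∀ y ∈ φ.target, ∀ a b, fderiv ℝ Θ y (Θ y a) b =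
      dirDeriv (dirDeriv φ (ℓ b)) (ℓ a) (φ.symm y) := by
    intro y hy a b
    have hy' : ContMDiffAt (𝓡 m) 𝓘(ℝ, Model m) ∞ φ (φ.symm y) :=
      contMDiffAt_extChartAt_of_mem (φ.map_target hy)
    rw [dirDeriv_eq_fderiv_chart hy
      (((hs b _).contMDiffAt_dirDeriv hy').mdifferentiableAt (by simp))]
    have h1 : HasFDerivAt (fun z => Θ z b) ((fderiv ℝ Θ y).flip b) y := by
      have := ((hcd y hy).differentiableAt (by simp)).hasFDerivAt.clm_apply
        (hasFDerivAt_const b y)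
      refine this.congr_fderiv ?_
      ext1 v
      simp
    have h2 : fderiv ℝ (dirDeriv φ (ℓ b) ∘ φ.symm) y = (fderiv ℝ Θ y).flip b := h1.fderiv
    rw [h2]
    rfl
  obtain ⟨ε, hε, r, hr, H⟩ := exists_integral_of_comm (Θ := Θ) (y₀ := φ p) (U := φ.target)
    (extChartAt_target_mem_nhds p) ((hcd _ (mem_extChartAt_target p)).of_le ENat.LEInfty.out)
    (fun y hy a b => by
      rw [hfd y hy, hfd y hy]
      exact dirDeriv_comm_of_bracket_eq_zero (hs a _) (hs b _)
        (contMDiffAt_extChartAt_of_mem (φ.map_target hy)) (hab a b _))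
  refine ⟨ε, hε, φ.source ∩ φ ⁻¹' ball (φ p) r,
    (continuousOn_extChartAt p).isOpen_inter_preimage (isOpen_extChartAt_source p) isOpen_ball,
    ⟨mem_extChartAt_source p, mem_ball_self hr⟩, fun y hy => ?_⟩
  obtain ⟨Φ, hΦ0, hΦ⟩ := H _ hy.2
  refine ⟨fun a => φ.symm (Φ a), by simp only [hΦ0]; exact φ.left_inv hy.1, fun a ha => ?_⟩
  obtain ⟨hat, had⟩ := hΦ a ha
  have h1 := (mdifferentiableAt_extChartAt_symm hat).hasMFDerivAt.comp a had.hasMFDerivAt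
  have h2 : (chartDsymm p (Φ a)).comp (Θ (Φ a)) = evalField ℓ (φ.symm (Φ a)) := by
    ext1 b
    exact chartDsymm_chartD hat _
  exact h2 ▸ h1

/-- Both sides move along integral curves of the same field `ℓ c` from a common point. Overlapping
plaques therefore differ by a translation of the parameter. -/
theorem IsPlaque.eq_of_eq [T2Space M] {ℓ : P →ₗ[ℝ] VField m M}
    (hs : ∀ b x, SmoothFieldAt (ℓ b) x) {ε ε' : ℝ} {Φ Ψ : P → M} (hΦ : IsPlaque ℓ ε Φ)
    (hΨ : IsPlaque ℓ ε' Ψ) {a a' c : P} (h : Φ a = Ψ a')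
    (ha : ∀ t ∈ Icc (0 : ℝ) 1, a + t • c ∈ ball (0 : P) ε)
    (ha' : ∀ t ∈ Icc (0 : ℝ) 1, a' + t • c ∈ ball (0 : P) ε') : Φ (a + c) = Ψ (a' + c) := by
  have := eqOn_of_isMIntegralCurveOn (hs c) (hΦ.isMIntegralCurveOn ha)
    (hΨ.isMIntegralCurveOn ha') (t₀ := 0) (by simp) (by simpa using h)
    (show (1 : ℝ) ∈ Icc (0 : ℝ) 1 by simp)
  simpa using this

/-- An orbit of a commutative family of vector fields is covered by countably many plaques. -/
theorem orbit_subset_countable_plaques [T2Space M] [SecondCountableTopology M]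
    {𝒳 : Submodule ℝ (VField m M)}
    (hs : ∀ X ∈ 𝒳, ∀ x, SmoothFieldAt X x) (hab : ∀ X ∈ 𝒳, ∀ Y ∈ 𝒳, ∀ x, bracket X Y x = 0)
    {ℓ : P →ₗ[ℝ] VField m M} (hℓ : ∀ b, ℓ b ∈ 𝒳) {x₀ : M}
    (hspan : ∀ X ∈ 𝒳, ∃ b, X x₀ = ℓ b x₀) :
    ∃ 𝒞 : Set (ℝ × (P → M)), 𝒞.Countable ∧ (∀ c ∈ 𝒞, IsPlaque ℓ c.1 c.2) ∧
      orbit 𝒳 x₀ ⊆ ⋃ c ∈ 𝒞, c.2 '' ball 0 c.1 := by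
  have hsℓ : ∀ b x, SmoothFieldAt (ℓ b) x := fun b => hs _ (hℓ b)
  have hex : ∀ p : M, ∃ ε > 0, ∃ N : Set M, IsOpen N ∧ p ∈ N ∧
      ∀ y ∈ N, ∃ Φ : P → M, Φ 0 = y ∧ IsPlaque ℓ ε Φ := fun p =>
    exists_isPlaque hsℓ (fun a b => hab _ (hℓ a) _ (hℓ b)) p
  choose ε hε N hNo hN hex using hex
  have : Nonempty M := ⟨x₀⟩
  choose! Φ hΦ0 hΦ using hex
  obtain ⟨S, hSc, hS⟩ := TopologicalSpace.countable_cover_nhds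
    (fun p => (hNo p).mem_nhds (hN p))
  have hcov : ∀ z, ∃ p ∈ S, z ∈ N p := fun z => by
    simpa using (hS ▸ mem_univ z : z ∈ ⋃ x ∈ S, N x)
  have hprop := FiniteDimensional.proper_real P
  obtain ⟨D, hDc, hD⟩ := TopologicalSpace.exists_countable_dense P
  have := hSc.to_subtype
  have := hDc.to_subtype
  -- Base points are reached from `x₀` by finitely many jumps inside plaques, with centers in the
  -- countable set `S` and parameters in the countable dense set `D`. Words passing through a point
  -- outside `N p` take arbitrary values; this is harmless, since a plaque enters `𝒞` only if its
  -- own base point lies in `N p`.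
  let word : List (S × D) → M := List.foldr (fun q y => Φ q.1 y q.2) x₀
  let 𝒞 : Set (ℝ × (P → M)) := {c | ∃ (w : List (S × D)) (p : S), word w ∈ N p ∧
    c = (ε p, Φ p (word w))}
  have hA : ∀ z, z ∈ (⋃ c ∈ 𝒞, c.2 '' ball 0 c.1) ↔
      ∃ (w : List (S × D)) (p : S), word w ∈ N p ∧ ∃ a ∈ ball (0 : P) (ε p),
        Φ p (word w) a = z := by
    intro z
    simp only [mem_iUnion, exists_prop]
    constructor
    · rintro ⟨_, ⟨w, p, hw, rfl⟩, a, ha, hz⟩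
      exact ⟨w, p, hw, a, ha, hz⟩
    · rintro ⟨w, p, hw, a, ha, hz⟩
      exact ⟨_, ⟨w, p, hw, rfl⟩, a, ha, hz⟩
  set A := ⋃ c ∈ 𝒞, c.2 '' ball (0 : P) c.1 with hAdef
  refine ⟨𝒞, ?_, ?_, ?_⟩
  · refine (countable_range fun q : List (S × D) × S => (ε q.2, Φ q.2 (word q.1))).mono ?_
    rintro _ ⟨w, p, -, rfl⟩
    exact ⟨(w, p), rfl⟩
  · rintro _ ⟨w, p, hw, rfl⟩
    exact hΦ _ _ hw
  -- A short curve which meets a plaque at parameter `a` is covered after a change of plaque: a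
  -- nearby `r ∈ D` gives a new base point in `N p`, and `γ s₁` has parameter `a - r` there. The
  -- offset `a - r` and the displacement along the curve each use less than half of the radius `ε
  -- p`.
  have hstep : ∀ (v : P) (γ : ℝ → M) (c d s₁ s₂ : ℝ) (p : M), p ∈ S →
      IsMIntegralCurveOn (I := 𝓡 m) γ (ℓ v) (Icc c d) → s₁ ∈ Icc c d → s₂ ∈ Icc c d →
      γ s₁ ∈ N p → (d - c) * ‖v‖ < ε p / 2 → γ s₁ ∈ A → γ s₂ ∈ A := by
    intro v γ c d s₁ s₂ p hpS hγ h₁ h₂ hp hv hz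
    obtain ⟨w, q, hw, a, ha, hwa⟩ := (hA _).1 hz
    have hnear : ∀ᶠ r in 𝓝 a, r ∈ ball (0 : P) (ε q) ∧ dist r a < ε p / 2 ∧
        Φ q (word w) r ∈ N p := by
      refine Filter.Eventually.and (isOpen_ball.mem_nhds ha)
        (Filter.Eventually.and (ball_mem_nhds a (half_pos (hε p))) ?_)
      exact ((hΦ _ _ hw).continuousAt ha).eventually ((hNo p).mem_nhds (hwa ▸ hp))
    obtain ⟨r, hrD, hr1, hr2, hr3⟩ := hD.inter_nhds_nonempty hnear
    have hw' : word ((q, ⟨r, hrD⟩) :: w) = Φ q (word w) r := rfl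
    rw [← hw'] at hr3
    set w' := ((q, ⟨r, hrD⟩) :: w : List (S × D)) with hw'def
    have hra : ‖a - r‖ < ε p / 2 := by rwa [← dist_eq_norm, dist_comm]
    have e1 : γ s₁ = Φ p (word w') (a - r) := by
      have := (hΦ _ _ hw).eq_of_eq hsℓ (hΦ _ _ hr3) (a := r) (a' := 0) (c := a - r)
        (by rw [hΦ0 _ _ hr3, hw'])
        (fun t ht => (convex_ball (0 : P) (ε q)).add_smul_sub_mem hr1 ha ht)
        (fun t ht => by
          rw [zero_add, mem_ball_zero_iff, norm_smul, Real.norm_of_nonneg ht.1]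
          nlinarith [ht.1, ht.2, norm_nonneg (a - r), hε p])
      rw [← hwa]
      simpa using this
    have hball : ∀ u ∈ Icc c d, (a - r - s₁ • v) + u • v ∈ ball (0 : P) (ε p) := by
      intro u hu
      rw [mem_ball_zero_iff]
      have h3 : a - r - s₁ • v + u • v = (a - r) + (u - s₁) • v := by rw [sub_smul]; abel
      rw [h3]
      refine (norm_add_le _ _).trans_lt ?_
      rw [norm_smul, Real.norm_eq_abs]
      have h4 : |u - s₁| ≤ d - c := by
        rw [abs_le]; constructor <;> linarith [hu.1, hu.2, h₁.1, h₁.2]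
      nlinarith [norm_nonneg v]
    have e2 := eqOn_of_isMIntegralCurveOn (hsℓ v) hγ
      ((hΦ _ _ hr3).isMIntegralCurveOn hball) h₁ (by simpa using e1) h₂
    rw [e2, hA]
    exact ⟨w', ⟨p, hpS⟩, hr3, _, hball _ h₂, rfl⟩
  intro z hz
  induction hz with
  | refl =>
    obtain ⟨p, hpS, hp⟩ := hcov x₀
    exact (hA _).2 ⟨[], ⟨p, hpS⟩, hp, 0, mem_ball_self (hε p), hΦ0 _ _ hp⟩
  | tail hy hst ih =>
    obtain ⟨X, hX, γ, a, b, hle, hγ, rfl, rfl⟩ := hst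
    obtain ⟨v, hv⟩ := hspan X hX
    -- `X - ℓ v` vanishes at `x₀`, hence on the orbit, so `γ` is also an integral curve of `ℓ v`.
    have hγv : IsMIntegralCurveOn (I := 𝓡 m) γ (ℓ v) (Icc a b) := by
      intro t ht
      have h1 : (X - ℓ v) (γ t) = 0 :=
        (eq_zero_iff_of_mem_orbit hs hab (𝒳.sub_mem hX (hℓ v))
          (mem_orbit_of_isMIntegralCurveOn hX hγ ht hy)).1 (sub_eq_zero.2 hv)
      have h2 : X (γ t) = ℓ v (γ t) := sub_eq_zero.1 h1
      exact h2 ▸ hγ t ht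
    refine (iff_of_eventually_iff (Q := fun t => γ t ∈ A) (fun t ht => ?_) ⟨le_rfl, hle⟩
      ⟨hle, le_rfl⟩).1 ih
    obtain ⟨p, hpS, hp⟩ := hcov (γ t)
    have hc := continuousWithinAt_curve hγ ht
    have hsmall : ∀ᶠ s in 𝓝[Icc a b] t, |s - t| * ‖v‖ < ε p / 2 := by
      have : ContinuousWithinAt (fun s : ℝ => |s - t| * ‖v‖) (Icc a b) t := by fun_prop
      refine this.eventually_lt continuousWithinAt_const ?_
      simpa using half_pos (hε p)
    have hRt : ∀ᶠ s in 𝓝[Icc a b] t, γ s ∈ N p := hc.eventually ((hNo p).mem_nhds hp)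
    filter_upwards [eventually_forall_uIcc ht hRt, hsmall] with s hs' hsm
    have hlen : (max t s - min t s) * ‖v‖ < ε p / 2 := by
      rwa [max_sub_min_eq_abs]
    exact ⟨hstep v γ _ _ t s p hpS (hγv.mono hs'.1) left_mem_uIcc right_mem_uIcc
        (hs'.2 t left_mem_uIcc) hlen,
      hstep v γ _ _ s t p hpS (hγv.mono hs'.1) right_mem_uIcc left_mem_uIcc
        (hs'.2 s right_mem_uIcc) hlen⟩

end Plaques

/-! ### Orbits that fill the fibers span the vertical directions -/

section Submersion

variable {m p : ℕ} {M : Type*} [TopologicalSpace M] [ChartedSpace (Model m) M]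
  [IsManifold (𝓡 m) ∞ M]
  {W : Type*} [TopologicalSpace W] [ChartedSpace (Model p) W]

omit [IsManifold (𝓡 m) ∞ M] in
theorem hasMFDerivAt_clm_comp {E G : Type*} [NormedAddCommGroup E] [NormedSpace ℝ E]
    [NormedAddCommGroup G] [NormedSpace ℝ G] (L : E →L[ℝ] G) {f : M → E} {x : M}
    {f' : Model m →L[ℝ] E} (hf : HasMFDerivAt (𝓡 m) 𝓘(ℝ, E) f x f') :
    HasMFDerivAt (𝓡 m) 𝓘(ℝ, G) (fun z => L (f z)) x (L.comp f') :=
  L.hasFDerivAt.hasMFDerivAt.comp x hf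

omit [IsManifold (𝓡 m) ∞ M] in
/-- A submersion has a complementary projection `pr`, which identifies a connected piece of the
fiber with a ball. -/
theorem exists_complementary_projection {F : Type*} [NormedAddCommGroup F] [NormedSpace ℝ F]
    {π : M → W} {x : M}
    (h : Manifold.IsSubmersionAtOfComplement F (𝓡 m) (𝓡 p) ∞ π x) :
    ∃ (pr : M → F) (S : Set M), IsOpen S ∧ x ∈ S ∧
      (∀ z ∈ S, MDifferentiableAt (𝓡 m) 𝓘(ℝ, F) pr z) ∧
      (∀ v : Tan m x, mfderiv (𝓡 m) (𝓡 p) π x v = 0 → dirDeriv pr (fun _ => v) x = 0 → v = 0) ∧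
      ∃ ρ > 0, ∃ K ⊆ S ∩ π ⁻¹' {π x}, IsPreconnected K ∧ x ∈ K ∧ ball (pr x) ρ ⊆ pr '' K := by
  set e := h.domChart.extend (𝓡 m) with he
  set c := h.codChart.extend (𝓡 p) with hc
  have hxs : x ∈ h.domChart.source := h.mem_domChart_source
  have hpxs : π x ∈ h.codChart.source := h.mem_codChart_source
  have hxe : x ∈ e.source := by rwa [he, h.domChart.extend_source]
  have hed : ∀ z ∈ h.domChart.source, MDifferentiableAt (𝓡 m) 𝓘(ℝ, Model m) e z := fun z hz =>
    (OpenPartialHomeomorph.contMDiffAt_extend h.domChart_mem_maximalAtlas hz).mdifferentiableAt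
      (by simp)
  have hwr : ∀ z ∈ h.domChart.source, c (π z) = (h.equiv (e z)).1 := by
    intro z hz
    have hz' : z ∈ e.source := by rwa [he, h.domChart.extend_source]
    have := h.writtenInCharts (e.map_source hz')
    simp only [Function.comp] at this
    rwa [← he, e.left_inv hz'] at this
  let L₁ : Model m →L[ℝ] Model p := (ContinuousLinearMap.fst ℝ (Model p) F).comp
    (h.equiv : Model m →L[ℝ] Model p × F)
  let L₂ : Model m →L[ℝ] F := (ContinuousLinearMap.snd ℝ (Model p) F).comp
    (h.equiv : Model m →L[ℝ] Model p × F)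
  refine ⟨fun z => L₂ (e z), h.domChart.source, h.domChart.open_source, hxs,
    fun z hz => (hasMFDerivAt_clm_comp L₂ (hed z hz).hasMFDerivAt).mdifferentiableAt,
    fun v hv₁ hv₂ => ?_, ?_⟩
  · have h1 : L₁ (dirDeriv e (fun _ => v) x) = 0 := by
      have hcd : MDifferentiableAt (𝓡 p) 𝓘(ℝ, Model p) c (π x) :=
        (OpenPartialHomeomorph.contMDiffAt_extend h.codChart_mem_maximalAtlas hpxs).mdifferentiableAt
          (by simp)
      have hπ : MDifferentiableAt (𝓡 m) (𝓡 p) π x := h.contMDiffAt.mdifferentiableAt (by simp)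
      have h2 := hcd.hasMFDerivAt.comp x hπ.hasMFDerivAt
      have h3 : c ∘ π =ᶠ[𝓝 x] fun z => L₁ (e z) := by
        filter_upwards [h.domChart.open_source.mem_nhds hxs] with z hz using hwr z hz
      have h4 := hasMFDerivAt_unique (h2.congr_of_eventuallyEq h3.symm)
        (hasMFDerivAt_clm_comp L₁ (hed x hxs).hasMFDerivAt)
      have h5 := congrArg (fun A : Model m →L[ℝ] Model p => A v) h4
      refine Eq.trans h5.symm ?_
      refine (congrArg (fun w => mfderiv (𝓡 p) 𝓘(ℝ, Model p) c (π x) w) hv₁).trans ?_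
      exact map_zero _
    have h2 : L₂ (dirDeriv e (fun _ => v) x) = 0 := by
      have := congrArg (fun A : Model m →L[ℝ] F => A v)
        (hasMFDerivAt_clm_comp L₂ (hed x hxs).hasMFDerivAt).mfderiv
      exact this.symm.trans hv₂
    have h3 : (dirDeriv e (fun _ => v) x) = 0 := by
      refine h.equiv.injective ?_
      rw [map_zero]
      exact Prod.ext h1 h2
    have hsd : MDifferentiableAt 𝓘(ℝ, Model m) (𝓡 m) e.symm (e x) := by
      refine ((contMDiffOn_extend_symm h.domChart_mem_maximalAtlas).contMDiffAt ?_).mdifferentiableAt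
        (by simp)
      have : (𝓡 m) '' h.domChart.target = e.target := by
        rw [he, h.domChart.extend_target]; simp
      rw [this]
      exact h.domChart.isOpen_extend_target.mem_nhds (e.map_source hxe)
    have h4 := hsd.hasMFDerivAt.comp x (hed x hxs).hasMFDerivAt
    have h5 : e.symm ∘ e =ᶠ[𝓝 x] id := by
      filter_upwards [h.domChart.open_source.mem_nhds hxs] with z hz
      exact h.domChart.extend_left_inv hz
    have h6 := hasMFDerivAt_unique (h4.congr_of_eventuallyEq h5.symm) (hasMFDerivAt_id x)
    have h7 := congrArg (fun A : Model m →L[ℝ] Model m => A v) h6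
    refine Eq.trans h7.symm ?_
    refine (congrArg (fun w => mfderiv 𝓘(ℝ, Model m) (𝓡 m) e.symm (e x) w) h3).trans ?_
    exact map_zero _
  -- In adapted charts `π` is the first projection; `j` parametrizes the slice through `x`, and the
  -- image of a small ball under `e.symm ∘ j` is the connected piece of the fiber.
  · let j : F → Model m := fun u => h.equiv.symm ((h.equiv (e x)).1, u)
    have hj : Continuous j := by fun_prop
    have hj1 : ∀ u, h.equiv (j u) = ((h.equiv (e x)).1, u) := fun u => by simp [j]
    have hjx : j (L₂ (e x)) = e x := h.equiv.injective (hj1 _)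
    have hto : IsOpen e.target := h.domChart.isOpen_extend_target
    obtain ⟨ρ, hρ, hb⟩ := Metric.isOpen_iff.1 (hto.preimage hj) (L₂ (e x))
      (by rw [mem_preimage, hjx]; exact e.map_source hxe)
    have hsrc : ∀ u ∈ ball (L₂ (e x)) ρ, e.symm (j u) ∈ h.domChart.source := fun u hu => by
      have := e.map_target (hb hu)
      rwa [he, h.domChart.extend_source] at this
    refine ⟨ρ, hρ, (e.symm ∘ j) '' ball (L₂ (e x)) ρ, ?_, ?_, ?_, ?_⟩
    · rintro _ ⟨u, hu, rfl⟩
      refine ⟨hsrc u hu, ?_⟩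
      have h1 : c (π (e.symm (j u))) = c (π x) := by
        rw [hwr _ (hsrc u hu), hwr x hxs, e.right_inv (hb hu), hj1]
      refine c.injOn ?_ ?_ h1 <;> rw [hc, h.codChart.extend_source]
      · exact h.source_subset_preimage_source (hsrc u hu)
      · exact hpxs
    · refine ((convex_ball _ _).isPreconnected).image _ ?_
      exact (h.domChart.continuousOn_extend_symm).comp hj.continuousOn fun u hu => hb hu
    · exact ⟨L₂ (e x), mem_ball_self hρ, by simp only [Function.comp, hjx]; exact e.left_inv hxe⟩
    · intro u hu
      refine ⟨_, ⟨u, hu, rfl⟩, ?_⟩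
      simp only [Function.comp, e.right_inv (hb hu)]
      exact congrArg Prod.snd (hj1 u)

/-- A family of vector fields whose orbits lie in the fibers is vertical. -/
theorem mfderiv_eq_zero_of_orbit_subset {𝒳 : Submodule ℝ (VField m M)} {π : M → W}
    (hs : ∀ X ∈ 𝒳, ∀ x, SmoothFieldAt X x) {x : M} (hπ : MDifferentiableAt (𝓡 m) (𝓡 p) π x)
    (horb : orbit 𝒳 x ⊆ π ⁻¹' {π x}) {X : VField m M} (hX : X ∈ 𝒳) :
    mfderiv (𝓡 m) (𝓡 p) π x (X x) = 0 := by
  have : IsManifold (𝓡 m) 1 M := IsManifold.of_le (n := ∞) ENat.LEInfty.out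
  obtain ⟨γ, rfl, hγ⟩ := exists_isMIntegralCurveAt_of_contMDiffAt_boundaryless (I := 𝓡 m) (0 : ℝ)
    ((hs X hX x).of_le ENat.LEInfty.out)
  obtain ⟨ε, hε, hγ'⟩ := isMIntegralCurveAt_iff'.1 hγ
  have hε' : (0 : ℝ) ≤ ε / 2 := (half_pos hε).le
  have hsub : Icc 0 (ε / 2) ⊆ ball (0 : ℝ) ε := fun t ht => by
    rw [mem_ball_zero_iff, Real.norm_of_nonneg ht.1]; linarith [ht.2]
  have h0 : (0 : ℝ) ∈ Icc 0 (ε / 2) := ⟨le_rfl, hε'⟩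
  have hγI := hγ'.mono hsub
  have h1 := hπ.hasMFDerivAt.comp_hasMFDerivWithinAt 0 (hγI 0 h0)
  have h2 : HasMFDerivWithinAt 𝓘(ℝ, ℝ) (𝓡 p) (π ∘ γ) (Icc 0 (ε / 2)) 0
      (0 : ℝ →L[ℝ] Model p) := by
    -- Orbits are followed forward in time, so `π ∘ γ` is known to be constant only for `t ≥ 0`; the
    -- derivative within the interval is still unique.
    refine (hasMFDerivAt_const (π (γ 0)) (0 : ℝ)).hasMFDerivWithinAt.congr_mono
      (fun t ht => ?_) rfl subset_rfl
    exact horb (mem_orbit_of_isMIntegralCurveOn hX hγI ht Relation.ReflTransGen.refl)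
  have h3 := (uniqueDiffOn_Icc (half_pos hε) 0 h0).uniqueMDiffWithinAt.eq h1 h2
  have h4 := congrArg (fun A : ℝ →L[ℝ] Model p => A 1) h3
  refine Eq.trans ?_ h4
  have h5 : ∀ (A : Model m →L[ℝ] Model p) (v : Model m),
      A v = A.comp ((1 : ℝ →L[ℝ] ℝ).smulRight v) 1 := fun A v => by simp
  exact h5 _ _

/-- A commutative family of vector fields whose orbits are the connected components of the fibers
of a submersion spans the tangent spaces of the fibers. -/
theorem exists_eq_of_mfderiv_eq_zero [T2Space M] [SecondCountableTopology M]
    {F : Type*} [NormedAddCommGroup F] [NormedSpace ℝ F] {𝒳 : Submodule ℝ (VField m M)}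
    {π : M → W} (hs : ∀ X ∈ 𝒳, ∀ x, SmoothFieldAt X x)
    (hab : ∀ X ∈ 𝒳, ∀ Y ∈ 𝒳, ∀ x, bracket X Y x = 0) {x : M}
    (h : Manifold.IsSubmersionAtOfComplement F (𝓡 m) (𝓡 p) ∞ π x)
    (horb : orbit 𝒳 x = connectedComponentIn (π ⁻¹' {π x}) x) {v : Tan m x}
    (hv : mfderiv (𝓡 m) (𝓡 p) π x v = 0) : ∃ X ∈ 𝒳, X x = v := by
  by_contra hcon
  obtain ⟨pr, S, hS, hxS, hpr, hinj, ρ, hρ, K, hK, hKc, hxK, hball⟩ :=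
    exists_complementary_projection h
  have hfin : FiniteDimensional ℝ F :=
    Module.Finite.of_surjective ((LinearMap.snd ℝ (Model p) F).comp
      (h.equiv : Model m →ₗ[ℝ] Model p × F))
      (Prod.snd_surjective.comp h.equiv.surjective)
  let ev : 𝒳 →ₗ[ℝ] Model m :=
    { toFun := fun X => (X : VField m M) x
      map_add' := fun _ _ => rfl
      map_smul' := fun _ _ => rfl }
  let D : Model m →L[ℝ] F := mfderiv (𝓡 m) 𝓘(ℝ, F) pr x
  have hev : ∀ w : ev.range, mfderiv (𝓡 m) (𝓡 p) π x (w : Model m) = 0 := by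
    rintro ⟨_, X, rfl⟩
    exact mfderiv_eq_zero_of_orbit_subset hs (h.contMDiffAt.mdifferentiableAt (by simp))
      (horb ▸ connectedComponentIn_subset _ _) X.2
  -- `D` is injective on vertical vectors, and the values of `𝒳` at `x` are vertical.
  obtain ⟨g, hg⟩ := ((D : Model m →ₗ[ℝ] F).comp ev.range.subtype).exists_leftInverse_of_injective
    (by
      refine LinearMap.ker_eq_bot'.2 fun w hw => Subtype.ext ?_
      exact hinj _ (hev w) hw)
  obtain ⟨s, hs'⟩ := ev.rangeRestrict.exists_rightInverse_of_surjective ev.range_rangeRestrict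
  have hgD : ∀ w : ev.range, g (D w) = w := fun w => LinearMap.congr_fun hg w
  have hes : ∀ w, ev (s w) = w := fun w => congrArg Subtype.val (LinearMap.congr_fun hs' w)
  -- The family is parametrized by all of `F`, not just by the span of `𝒳` at `x`. Then `pr`
  -- composed with a plaque maps `F` to `F`, and the vanishing of a determinant makes its image
  -- null.
  let ℓ : F →ₗ[ℝ] VField m M := 𝒳.subtype.comp (s.comp g)
  -- The part of `D v` missed by the values of `𝒳`. The family sends `b` to the zero field, and `b =
  -- 0` would put `v` among these values.
  let b : F := D v - D (g (D v))
  have hgb : g b = 0 := by rw [map_sub, hgD, sub_self]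
  have hb : b ≠ 0 := by
    intro hb
    let u : Model m := v
    let Dπ : Model m →L[ℝ] Model p := mfderiv (𝓡 m) (𝓡 p) π x
    have h1 : D (u - g (D u)) = 0 := (map_sub _ _ _).trans hb
    have h2 : Dπ (u - g (D u)) = 0 := by
      rw [map_sub, show Dπ u = 0 from hv, show Dπ (g (D u) : Model m) = 0 from hev _, sub_self]
    have h4 : u = g (D u) := sub_eq_zero.1 (hinj _ h2 h1)
    obtain ⟨X, hX⟩ := (g (D v)).2
    exact hcon ⟨X, X.2, hX.trans h4.symm⟩
  have hℓb : ℓ b = 0 := by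
    change ((s (g b) : 𝒳) : VField m M) = 0
    rw [hgb, map_zero]; rfl
  obtain ⟨𝒞, h𝒞, hpl, hcov⟩ := orbit_subset_countable_plaques hs hab (ℓ := ℓ)
    (fun b => (s (g b)).2) (x₀ := x) (fun X hX => by
      let w : ev.range := ⟨ev ⟨X, hX⟩, _, rfl⟩
      refine ⟨D w, ?_⟩
      change X x = ev (s (g (D w)))
      rw [hes, hgD]; rfl)
  let _ : MeasurableSpace F := borel F
  have : BorelSpace F := ⟨rfl⟩
  let μ : MeasureTheory.Measure F := MeasureTheory.Measure.addHaar
  have hnull : ∀ c ∈ 𝒞, μ ((pr ∘ c.2) '' (ball 0 c.1 ∩ c.2 ⁻¹' S)) = 0 := by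
    intro c hc
    let A : F → F →L[ℝ] F := fun a =>
      (show Model m →L[ℝ] F from mfderiv (𝓡 m) 𝓘(ℝ, F) pr (c.2 a)).comp (evalField ℓ (c.2 a))
    refine MeasureTheory.addHaar_image_eq_zero_of_det_fderivWithin_eq_zero μ (f' := A) ?_ ?_
    · intro a ha
      exact ((hpr _ ha.2).hasMFDerivAt.comp a (hpl c hc a ha.1)).hasFDerivAt.hasFDerivWithinAt
    · intro a ha
      -- The plaque does not move in the direction `b`, so the derivative kills `b`.
      refine LinearMap.det_eq_zero_iff_ker_ne_bot.2 fun hker => hb ?_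
      refine LinearMap.ker_eq_bot'.1 hker b ?_
      change mfderiv (𝓡 m) 𝓘(ℝ, F) pr (c.2 a) (ℓ b (c.2 a)) = 0
      rw [hℓb]
      exact map_zero _
  have hsub : ball (pr x) ρ ⊆ ⋃ c ∈ 𝒞, (pr ∘ c.2) '' (ball 0 c.1 ∩ c.2 ⁻¹' S) := by
    intro u hu
    obtain ⟨z, hz, rfl⟩ := hball hu
    have hzo : z ∈ orbit 𝒳 x := horb ▸ hKc.subset_connectedComponentIn hxK
      (hK.trans inter_subset_right) hz
    obtain ⟨c, hc, a, ha, rfl⟩ := mem_iUnion₂.1 (hcov hzo)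
    exact mem_iUnion₂.2 ⟨c, hc, a, ⟨ha, (hK hz).1⟩, rfl⟩
  have := MeasureTheory.measure_mono_null hsub
    ((MeasureTheory.measure_biUnion_null_iff h𝒞).2 hnull)
  exact (measure_ball_pos μ (pr x) hρ).ne' this

end Submersion

/-! ### Linear algebra of `a ∧ bⁿ` -/

section Wedge

variable {V : Type*} [NormedAddCommGroup V] [NormedSpace ℝ V]

/-- A finite-dimensional space has a basis which starts with a given vector and continues in the
kernel of a functional not vanishing on that vector. -/
theorem exists_basis_cons {k : ℕ} (hk : Module.finrank ℝ V = k + 1) {f : V →L[ℝ] ℝ} {w : V}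
    (hw : f w ≠ 0) :
    ∃ e : Module.Basis (Fin (k + 1)) ℝ V, e 0 = w ∧ ∀ i, i ≠ 0 → f (e i) = 0 := by
  have : FiniteDimensional ℝ V := Module.finite_of_finrank_eq_succ hk
  let N : Submodule ℝ V := (f : V →ₗ[ℝ] ℝ).ker
  have hN : Module.finrank ℝ N = k := by
    have h1 := (f : V →ₗ[ℝ] ℝ).finrank_range_add_finrank_ker
    have h2 : (f : V →ₗ[ℝ] ℝ).range = ⊤ :=
      LinearMap.range_eq_top.2 (LinearMap.surjective fun h => hw (LinearMap.congr_fun h w))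
    rw [h2, finrank_top, Module.finrank_self, hk] at h1
    change Module.finrank ℝ (f : V →ₗ[ℝ] ℝ).ker = k
    omega
  let b := Module.finBasisOfFinrankEq ℝ N hN
  have hli : ∀ (c : ℝ), ∀ x ∈ N, c • w + x = 0 → c = 0 := by
    intro c x hx h
    have h1 := congrArg f h
    rw [map_add, map_smul, show f x = 0 from hx, add_zero, map_zero, smul_eq_mul] at h1
    exact (mul_eq_zero.1 h1).resolve_right hw
  have hsp : ∀ z : V, ∃ c : ℝ, z + c • w ∈ N := fun z =>
    ⟨-(f z / f w), by
      change f _ = 0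
      rw [map_add, map_smul, smul_eq_mul]
      field_simp
      ring⟩
  refine ⟨Module.Basis.mkFinCons w b hli hsp, ?_, fun i hi => ?_⟩
  · rw [Module.Basis.coe_mkFinCons]; rfl
  · obtain ⟨j, rfl⟩ := Fin.exists_succ_eq.2 hi
    rw [Module.Basis.coe_mkFinCons, Fin.cons_succ]
    exact (b j).2

/-- The multilinear form whose alternatization is `wedgePow`. -/
def wedgeMultilinear (n : ℕ) (a : V →L[ℝ] ℝ) (b : V →L[ℝ] V →L[ℝ] ℝ) :
    MultilinearMap ℝ (fun _ : Fin (2 * n + 1) => V) ℝ :=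
  -- Each slot occurs in exactly one factor, and that factor is linear in it.
  have key : ∀ [DecidableEq (Fin (2 * n + 1))] (v : Fin (2 * n + 1) → V) (j : Fin (2 * n + 1)),
      ∃ L : V →L[ℝ] ℝ, ∀ x, a (Function.update v j x 0) *
        ∏ i : Fin n, b (Function.update v j x ⟨2 * i.val + 1, by omega⟩)
          (Function.update v j x ⟨2 * i.val + 2, by omega⟩) = L x := by
    intro _ v j
    by_cases hj : j.val = 0
    · obtain rfl : j = 0 := Fin.ext hj
      refine ⟨(∏ i : Fin n, b (v ⟨2 * i.val + 1, by omega⟩) (v ⟨2 * i.val + 2, by omega⟩)) • a,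
        fun x => ?_⟩
      rw [Function.update_self, smul_apply, smul_eq_mul, mul_comm]
      congr 1
      refine Finset.prod_congr rfl fun i _ => ?_
      rw [Function.update_of_ne, Function.update_of_ne] <;>
        · intro h; have := congrArg Fin.val h; simp at this
    · have h0 : (0 : Fin (2 * n + 1)) ≠ j := fun h => hj (h ▸ rfl)
      -- The factor containing slot `j ≥ 1`: `j` is its left argument if odd and its right argument
      -- if even.
      let i : Fin n := ⟨(j.val - 1) / 2, by omega⟩
      let c : ℝ := a (v 0) * ∏ i' ∈ Finset.univ.erase i,
        b (v ⟨2 * i'.val + 1, by omega⟩) (v ⟨2 * i'.val + 2, by omega⟩)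
      have hc : ∀ x, a (Function.update v j x 0) * ∏ i' ∈ Finset.univ.erase i,
          b (Function.update v j x ⟨2 * i'.val + 1, by omega⟩)
            (Function.update v j x ⟨2 * i'.val + 2, by omega⟩) = c := by
        intro x
        rw [Function.update_of_ne h0]
        congr 1
        refine Finset.prod_congr rfl fun i' hi' => ?_
        have h1 : i'.val ≠ (j.val - 1) / 2 := fun h => Finset.ne_of_mem_erase hi' (Fin.ext h)
        rw [Function.update_of_ne, Function.update_of_ne] <;>
          · intro h; have := congrArg Fin.val h; simp only at this; omega
      have hsplit : ∀ x, a (Function.update v j x 0) *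
          ∏ i : Fin n, b (Function.update v j x ⟨2 * i.val + 1, by omega⟩)
            (Function.update v j x ⟨2 * i.val + 2, by omega⟩) =
          c * b (Function.update v j x ⟨2 * i.val + 1, by omega⟩)
            (Function.update v j x ⟨2 * i.val + 2, by omega⟩) := fun x => by
        rw [← hc x, ← Finset.prod_erase_mul _ _ (Finset.mem_univ i), mul_assoc]
      rcases Nat.even_or_odd' j.val with ⟨q, hq | hq⟩
      · refine ⟨c • b (v ⟨2 * i.val + 1, by omega⟩), fun x => ?_⟩
        rw [hsplit, Function.update_of_ne (by
            intro h; have := congrArg Fin.val h; simp only [i] at this; omega),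
          show (⟨2 * i.val + 2, by omega⟩ : Fin (2 * n + 1)) = j from
            Fin.ext (by simp only [i]; omega), Function.update_self, smul_apply, smul_eq_mul]
      · refine ⟨c • b.flip (v ⟨2 * i.val + 2, by omega⟩), fun x => ?_⟩
        have h2 : (⟨2 * i.val + 2, by omega⟩ : Fin (2 * n + 1)) ≠ j := by
          intro h; have := congrArg Fin.val h; simp only [i] at this; omega
        rw [hsplit, Function.update_of_ne h2,
          show (⟨2 * i.val + 1, by omega⟩ : Fin (2 * n + 1)) = j from
            Fin.ext (by simp only [i]; omega), Function.update_self, smul_apply, smul_eq_mul,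
          ContinuousLinearMap.flip_apply]
  { toFun := fun v => a (v 0) *
      ∏ i : Fin n, b (v ⟨2 * i.val + 1, by omega⟩) (v ⟨2 * i.val + 2, by omega⟩)
    map_update_add' := by
      intro _ v j x y
      obtain ⟨L, hL⟩ := key v j
      rw [hL, hL, hL, map_add]
    map_update_smul' := by
      intro _ v j c x
      obtain ⟨L, hL⟩ := key v j
      rw [hL, hL, map_smul] }

/-- As an alternating form of top degree, the sum is its value on a basis times the determinant. -/
theorem wedgePow_eq_alternatization (n : ℕ) (a : V →L[ℝ] ℝ) (b : V →L[ℝ] V →L[ℝ] ℝ)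
    (v : Fin (2 * n + 1) → V) :
    wedgePow n (fun u => a u) (fun u w => b u w) v =
      MultilinearMap.alternatization (wedgeMultilinear n a b) v := by
  rw [MultilinearMap.alternatization_apply]
  refine Finset.sum_congr rfl fun σ _ => ?_
  rw [MultilinearMap.domDomCongr_apply]
  simp only [Units.smul_def, zsmul_eq_mul]
  rfl

variable {n : ℕ} {a : V →L[ℝ] ℝ} {b : V →L[ℝ] V →L[ℝ] ℝ}

/-- If `a ∧ bⁿ` does not vanish, it does not vanish on any basis. -/
theorem wedgePow_basis_ne_zero (e : Module.Basis (Fin (2 * n + 1)) ℝ V)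
    {v : Fin (2 * n + 1) → V} (hv : wedgePow n (fun u => a u) (fun u w => b u w) v ≠ 0) :
    wedgePow n (fun u => a u) (fun u w => b u w) e ≠ 0 := by
  rw [wedgePow_eq_alternatization] at hv ⊢
  intro h
  have := (MultilinearMap.alternatization (wedgeMultilinear n a b)).eq_smul_basis_det e
  rw [h, zero_smul] at this
  exact hv (by rw [this]; rfl)

theorem exists_ne_zero_of_wedgePow {v : Fin (2 * n + 1) → V}
    (hv : wedgePow n (fun u => a u) (fun u w => b u w) v ≠ 0) : ∃ w, a w ≠ 0 := by
  by_contra! h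
  exact hv (by simp [wedgePow, h])

/-- If `a ∧ bⁿ` does not vanish, no nonzero vector is annihilated both by `a` and by `b`. -/
theorem eq_zero_of_wedgePow (hV : Module.finrank ℝ V = 2 * n + 1) {v : Fin (2 * n + 1) → V}
    (hv : wedgePow n (fun u => a u) (fun u w => b u w) v ≠ 0) {w : V} (ha : a w = 0)
    (hb : ∀ u, b w u = 0) (hb' : ∀ u, b u w = 0) : w = 0 := by
  by_contra hw
  have : FiniteDimensional ℝ V := Module.finite_of_finrank_eq_succ hV
  obtain ⟨f, hf⟩ := SeparatingDual.exists_ne_zero (R := ℝ) hw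
  obtain ⟨e, he, -⟩ := exists_basis_cons hV hf
  refine wedgePow_basis_ne_zero e hv (Finset.sum_eq_zero fun σ _ => ?_)
  -- The vector `w` is `e 0`; in the summand of `σ` it occupies slot `j`, and the factor containing
  -- this slot vanishes.
  obtain ⟨j, hj⟩ := σ.surjective 0
  have hej : e (σ j) = w := by rw [hj, he]
  refine mul_eq_zero_of_right _ ?_
  by_cases h0 : j.val = 0
  · obtain rfl : j = 0 := Fin.ext h0
    simp only [hej, ha, zero_mul]
  · refine mul_eq_zero_of_right _
      (Finset.prod_eq_zero (Finset.mem_univ (⟨(j.val - 1) / 2, by omega⟩ : Fin n)) ?_)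
    rcases Nat.even_or_odd' j.val with ⟨q, hq | hq⟩
    · rw [show (⟨2 * ((j.val - 1) / 2) + 2, by omega⟩ : Fin (2 * n + 1)) = j from
        Fin.ext (by simp only; omega), hej]
      exact hb' _
    · rw [show (⟨2 * ((j.val - 1) / 2) + 1, by omega⟩ : Fin (2 * n + 1)) = j from
        Fin.ext (by simp only; omega), hej]
      exact hb _

/-- The nonvanishing of `a ∧ bⁿ` depends on `a`, and on the restriction of `b` to the kernel of
`a`, up to factors only. -/
theorem exists_wedgePow_smul_ne_zero (hV : Module.finrank ℝ V = 2 * n + 1)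
    {v : Fin (2 * n + 1) → V} (hv : wedgePow n (fun u => a u) (fun u w => b u w) v ≠ 0)
    {a' : V →L[ℝ] ℝ} {b' : V →L[ℝ] V →L[ℝ] ℝ} {c : ℝ} (hc : c ≠ 0) (ha : a' = c • a)
    (hb : ∀ u w, a u = 0 → a w = 0 → b' u w = c * b u w) :
    ∃ v, wedgePow n (fun u => a' u) (fun u w => b' u w) v ≠ 0 := by
  obtain ⟨w, hw⟩ := exists_ne_zero_of_wedgePow hv
  obtain ⟨e, -, he⟩ := exists_basis_cons hV hw
  refine ⟨e, ?_⟩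
  have key : wedgePow n (fun u => a' u) (fun u w => b' u w) e =
      c ^ (n + 1) * wedgePow n (fun u => a u) (fun u w => b u w) e := by
    rw [wedgePow, wedgePow, Finset.mul_sum]
    refine Finset.sum_congr rfl fun σ _ => ?_
    rw [ha, smul_apply, smul_eq_mul]
    -- All basis vectors except `e 0` lie in the kernel of `a`. Only permutations fixing `0`
    -- contribute, and for them `b` is evaluated on kernel vectors, whence the factor `c * c ^ n`.
    by_cases h0 : σ 0 = 0
    · have h1 : ∀ j, j ≠ 0 → a (e (σ j)) = 0 := fun j hj =>
        he _ fun h => hj (σ.injective (h.trans h0.symm))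
      have h2 : ∏ i : Fin n, b' (e (σ ⟨2 * i.val + 1, by omega⟩))
            (e (σ ⟨2 * i.val + 2, by omega⟩)) =
          c ^ n * ∏ i : Fin n, b (e (σ ⟨2 * i.val + 1, by omega⟩))
            (e (σ ⟨2 * i.val + 2, by omega⟩)) := by
        rw [Finset.prod_congr rfl fun i _ => hb _ _ (h1 _ ?_) (h1 _ ?_), Finset.prod_mul_distrib,
          Finset.prod_const, Finset.card_univ, Fintype.card_fin] <;>
        · intro h; have := congrArg Fin.val h; simp at this
      rw [h2]; ring
    · rw [he _ h0]; ring
  rw [key]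
  exact mul_ne_zero (pow_ne_zero _ hc) (wedgePow_basis_ne_zero e hv)

end Wedge

/-! ### Lie derivatives and rescaling of forms -/

section Calculus

variable {m : ℕ} {M : Type*} [TopologicalSpace M] [ChartedSpace (Model m) M]
  {G : Type*} [NormedAddCommGroup G] [NormedSpace ℝ G]

theorem dirDeriv_congr {h₁ h₂ : M → G} {x : M} (h : h₁ =ᶠ[𝓝 x] h₂) (X : VField m M) :
    dirDeriv h₁ X x = dirDeriv h₂ X x := by
  have h1 : (mfderiv (𝓡 m) 𝓘(ℝ, G) h₁ x : Model m →L[ℝ] G) =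
    mfderiv (𝓡 m) 𝓘(ℝ, G) h₂ x := h.mfderiv_eq
  exact congrArg (fun A : Model m →L[ℝ] G => A (X x)) h1

theorem diff_eq_zero_of_eventually_const {h : M → ℝ} {x : M} {c : ℝ} (hc : ∀ᶠ y in 𝓝 x, h y = c) :
    diff (m := m) h x = 0 := by
  have h1 : (diff (m := m) h x : Model m →L[ℝ] ℝ) = mfderiv (𝓡 m) 𝓘(ℝ, ℝ) (fun _ : M => c) x :=
    Filter.EventuallyEq.mfderiv_eq (show h =ᶠ[𝓝 x] fun _ => c from hc)
  exact h1.trans mfderiv_const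

theorem dirDeriv_eq_zero_of_eventually_const {h : M → ℝ} {x : M} {c : ℝ}
    (hc : ∀ᶠ y in 𝓝 x, h y = c) (X : VField m M) : dirDeriv h X x = 0 := by
  have := diff_eq_zero_of_eventually_const (m := m) hc
  exact congrArg (fun A : Model m →L[ℝ] ℝ => A (X x)) this

theorem dirDeriv_mul {f g : M → ℝ} {x : M} (hf : MDifferentiableAt (𝓡 m) 𝓘(ℝ, ℝ) f x)
    (hg : MDifferentiableAt (𝓡 m) 𝓘(ℝ, ℝ) g x) (X : VField m M) :
    dirDeriv (fun y => f y * g y) X x = f x * dirDeriv g X x + dirDeriv f X x * g x := by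
  have h1 := (hf.hasMFDerivAt.mul hg.hasMFDerivAt).mfderiv
  have h2 := congrArg (fun A : Model m →L[ℝ] ℝ => A (X x)) h1
  refine Eq.trans h2 ?_
  rw [mul_comm (dirDeriv f X x)]
  rfl

theorem contMDiffAt_clm_of_apply {V : Type*} [NormedAddCommGroup V] [NormedSpace ℝ V]
    [FiniteDimensional ℝ V] {f : M → V →L[ℝ] G} {x : M}
    (h : ∀ v, ContMDiffAt (𝓡 m) 𝓘(ℝ, G) ∞ (fun y => f y v) x) :
    ContMDiffAt (𝓡 m) 𝓘(ℝ, V →L[ℝ] G) ∞ f x := by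
  let d := Module.finrank ℝ V
  have hd : d = Module.finrank ℝ (Fin d → ℝ) := (Module.finrank_fin_fun ℝ).symm
  let e₁ := ContinuousLinearEquiv.ofFinrankEq hd
  let e₂ := (e₁.arrowCongr (1 : G ≃L[ℝ] G)).trans (ContinuousLinearEquiv.piRing (Fin d))
  have h1 : ContMDiffAt (𝓡 m) 𝓘(ℝ, Fin d → G) ∞ (fun y => e₂ (f y)) x :=
    contMDiffAt_pi_space.2 fun i => h _
  have h2 : f = fun y => e₂.symm (e₂ (f y)) := by
    funext y; rw [e₂.symm_apply_apply]
  rw [h2]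
  exact e₂.symm.contDiff.contDiffAt.contMDiffAt.comp x h1

theorem bracket_eq_zero_of_eventually_zero_left {X Y : VField m M} {x : M}
    (hX : ∀ᶠ y in 𝓝 x, X y = 0) : bracket X Y x = 0 := by
  have h1 : X =ᶠ[𝓝 x] 0 := hX
  have h2 : bracket X Y x = VectorField.mlieBracket (𝓡 m) 0 Y x :=
    h1.mlieBracket_vectorField_eq (EventuallyEq.refl _ _)
  rw [h2, VectorField.mlieBracket_zero_left]; rfl

theorem bracket_eq_zero_of_eventually_zero_right {X Y : VField m M} {x : M}
    (hY : ∀ᶠ y in 𝓝 x, Y y = 0) : bracket X Y x = 0 := by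
  have h1 : Y =ᶠ[𝓝 x] 0 := hY
  have h2 : bracket X Y x = VectorField.mlieBracket (𝓡 m) X 0 x :=
    (EventuallyEq.refl _ _).mlieBracket_vectorField_eq h1
  rw [h2, VectorField.mlieBracket_zero_right]; rfl

variable [IsManifold (𝓡 m) ∞ M]

theorem SmoothFormAt.congr_smul {α β : OneForm m M} {g : M → ℝ} {x : M} (hβ : SmoothFormAt β x)
    (hg : ContMDiffAt (𝓡 m) 𝓘(ℝ, ℝ) ∞ g x) (h : ∀ᶠ y in 𝓝 x, α y = g y • β y) :
    SmoothFormAt α x := by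
  have h1 := hg.smul_section (V := fun y : M => TangentSpace (𝓡 m) y →L[ℝ] Bundle.Trivial M ℝ y)
    (F := Model m →L[ℝ] ℝ) (s := β) hβ
  refine h1.congr_of_eventuallyEq ?_
  filter_upwards [h] with y hy
  exact congrArg (Bundle.TotalSpace.mk' (Model m →L[ℝ] ℝ)
    (E := fun z : M => TangentSpace (𝓡 m) z →L[ℝ] Bundle.Trivial M ℝ z) y) hy

theorem smoothFieldAt_coord {u : M → Model m} {X : VField m M} {x : M}
    (hu : ContMDiffAt (𝓡 m) 𝓘(ℝ, Model m) ∞ u x)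
    (hX : ∀ᶠ y in 𝓝 x, X y = coordField x (u y) y) : SmoothFieldAt X x := by
  let b := EuclideanSpace.basisFun (Fin m) ℝ
  have h1 := ContMDiffAt.sum_section (V := fun y : M => TangentSpace (𝓡 m) y) (F := Model m)
    (s := Finset.univ) (t := fun i y => u y i • coordField x (b i) y) (x₀ := x) (n := ∞)
    (I := 𝓡 m) fun i _ =>
      ContMDiffAt.smul_section (V := fun y : M => TangentSpace (𝓡 m) y) (F := Model m)
        (((EuclideanSpace.proj i : Model m →L[ℝ] ℝ).contDiff.contDiffAt.contMDiffAt).comp x hu)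
        (smoothFieldAt_coordField (mem_extChartAt_source x) (b i))
  refine h1.congr_of_eventuallyEq ?_
  filter_upwards [hX] with y hy
  refine congrArg (Bundle.TotalSpace.mk' (Model m) (E := fun z : M => TangentSpace (𝓡 m) z) y)
    (hy.trans ?_)
  have h2 : ∀ A : Model m →L[ℝ] Model m, A (u y) = ∑ i, u y i • A (b i) := fun A => by
    conv_lhs => rw [← b.sum_repr (u y)]
    rw [map_sum]
    simp [b]
  exact h2 _

theorem SmoothFormAt.contMDiffAt_extD_apply {α : OneForm m M} {X Y : VField m M} {x : M}
    (hα : ∀ᶠ y in 𝓝 x, SmoothFormAt α y) (hX : ∀ᶠ y in 𝓝 x, SmoothFieldAt X y)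
    (hY : ∀ᶠ y in 𝓝 x, SmoothFieldAt Y y) :
    ContMDiffAt (𝓡 m) 𝓘(ℝ, ℝ) ∞ (fun y => extD α y (X y) (Y y)) x := by
  have hα' := hα.self_of_nhds
  have hX' := hX.self_of_nhds
  have hY' := hY.self_of_nhds
  refine (((hX'.contMDiffAt_dirDeriv (hα'.contMDiffAt_apply hY')).sub
    (hY'.contMDiffAt_dirDeriv (hα'.contMDiffAt_apply hX'))).sub
    (hα'.contMDiffAt_apply (hX'.bracket hY'))).congr_of_eventuallyEq ?_
  filter_upwards [hα, hX, hY] with y h1 h2 h3 using extD_apply h1 h2 h3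

/-- `(L_X α)(Y) = X(α(Y)) - α([X, Y])`. -/
theorem lieD_apply {α : OneForm m M} {X Y : VField m M} {x : M}
    (hα : SmoothFormAt α x) (hX : SmoothFieldAt X x) (hY : SmoothFieldAt Y x) :
    lieD X α x (Y x) = dirDeriv (fun y => α y (Y y)) X x - α x (bracket X Y x) := by
  have h1 : lieD X α x (Y x) = extD α x (X x) (Y x) + dirDeriv (fun y => α y (X y)) Y x := rfl
  rw [h1, extD_apply hα hX hY]
  ring

/-- This reflects `L_[X,Y] = [L_X, L_Y]`. Tested on a field `Q`, invariance moves both derivations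
inside `α`, and the Jacobi identity cancels the three terms. -/
theorem lieD_bracket_eq_zero {α : OneForm m M} {X Y : VField m M} {x : M}
    (hα : ∀ᶠ y in 𝓝 x, SmoothFormAt α y) (hX : ∀ᶠ y in 𝓝 x, SmoothFieldAt X y)
    (hY : ∀ᶠ y in 𝓝 x, SmoothFieldAt Y y) (hXα : ∀ᶠ y in 𝓝 x, lieD X α y = 0)
    (hYα : ∀ᶠ y in 𝓝 x, lieD Y α y = 0) : lieD (bracket X Y) α x = 0 := by
  ext v
  obtain ⟨Q, rfl, hQ⟩ := exists_smoothField_eq x v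
  have hα' := hα.self_of_nhds
  have hX' := hX.self_of_nhds
  have hY' := hY.self_of_nhds
  have hQ' := hQ.self_of_nhds
  have key : ∀ {Z : VField m M} {P : VField m M} {y : M}, SmoothFormAt α y → SmoothFieldAt Z y →
      SmoothFieldAt P y → lieD Z α y = 0 →
      dirDeriv (fun z => α z (P z)) Z y = α y (bracket Z P y) := by
    intro Z P y h1 h2 h3 h4
    have h5 := lieD_apply h1 h2 h3
    rw [h4] at h5
    exact (sub_eq_zero.1 h5.symm)
  rw [lieD_apply hα' (hX'.bracket hY') hQ', dirDeriv_bracket hX' hY' (hα'.contMDiffAt_apply hQ')]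
  have e1 : dirDeriv (dirDeriv (fun y => α y (Q y)) Y) X x = α x (bracket X (bracket Y Q) x) := by
    rw [dirDeriv_congr (h₂ := fun y => α y (bracket Y Q y)),
      key hα' hX' (hY'.bracket hQ') hXα.self_of_nhds]
    filter_upwards [hα, hY, hQ, hYα] with y h1 h2 h3 h4 using key h1 h2 h3 h4
  have e2 : dirDeriv (dirDeriv (fun y => α y (Q y)) X) Y x = α x (bracket Y (bracket X Q) x) := by
    rw [dirDeriv_congr (h₂ := fun y => α y (bracket X Q y)),
      key hα' hY' (hX'.bracket hQ') hYα.self_of_nhds]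
    filter_upwards [hα, hX, hQ, hXα] with y h1 h2 h3 h4 using key h1 h2 h3 h4
  rw [e1, e2, bracket_bracket hX' hY' hQ', map_add]
  simp

/-- Rescaling a 1-form rescales its exterior derivative on the kernel. -/
theorem extD_of_eventuallyEq_smul {α β : OneForm m M} {g : M → ℝ} {x : M}
    (hβ : SmoothFormAt β x) (hg : ContMDiffAt (𝓡 m) 𝓘(ℝ, ℝ) ∞ g x)
    (h : ∀ᶠ y in 𝓝 x, α y = g y • β y) {u w : Tan m x} (hu : β x u = 0) (hw : β x w = 0) :
    extD α x u w = g x * extD β x u w := by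
  obtain ⟨X, rfl, hX⟩ := exists_smoothField_eq x u
  obtain ⟨Y, rfl, hY⟩ := exists_smoothField_eq x w
  have hX' := hX.self_of_nhds
  have hY' := hY.self_of_nhds
  -- The derivative of `g` appears only with the factor `β(P)`, which is zero at `x`.
  have key : ∀ {P Q : VField m M}, SmoothFieldAt P x → β x (P x) = 0 →
      dirDeriv (fun y => α y (P y)) Q x = g x * dirDeriv (fun y => β y (P y)) Q x := by
    intro P Q hP h0
    have h1 : (fun y => α y (P y)) =ᶠ[𝓝 x] fun y => g y * β y (P y) := by
      filter_upwards [h] with y hy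
      rw [hy]; rfl
    rw [dirDeriv_congr h1, dirDeriv_mul (hg.mdifferentiableAt (by simp))
      ((hβ.contMDiffAt_apply hP).mdifferentiableAt (by simp)), h0, mul_zero, add_zero]
  rw [extD_apply (hβ.congr_smul hg h) hX' hY', extD_apply hβ hX' hY', key hX' hu, key hY' hw,
    h.self_of_nhds]
  rw [mul_sub, mul_sub]
  rfl

end Calculus

/-! ### Inverting `v ↦ α(v) α - i_v dα` -/

section Flat

variable {m : ℕ} {M : Type*} [TopologicalSpace M] [ChartedSpace (Model m) M]

theorem exists_equiv_dual_of_injective {V : Type*} [NormedAddCommGroup V] [NormedSpace ℝ V]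
    [FiniteDimensional ℝ V] {T : V →L[ℝ] V →L[ℝ] ℝ} (hT : ∀ v, T v = 0 → v = 0) :
    ∃ e : V ≃L[ℝ] (V →L[ℝ] ℝ), (e : V →L[ℝ] V →L[ℝ] ℝ) = T := by
  have hd : Module.finrank ℝ V = Module.finrank ℝ (V →L[ℝ] ℝ) := by
    rw [← (LinearMap.toContinuousLinearMap (E := V) (F' := ℝ) (𝕜 := ℝ)).finrank_eq,
      Subspace.dual_finrank_eq]
  refine ⟨(LinearMap.linearEquivOfInjective (T : V →ₗ[ℝ] V →L[ℝ] ℝ)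
    ((injective_iff_map_eq_zero _).2 hT) hd).toContinuousLinearEquiv, ?_⟩
  ext v w
  rfl

theorem inverse_apply_apply {V : Type*} [NormedAddCommGroup V] [NormedSpace ℝ V]
    [FiniteDimensional ℝ V] {T : V →L[ℝ] V →L[ℝ] ℝ} (hT : ∀ v, T v = 0 → v = 0) (v : V) :
    T.inverse (T v) = v := by
  obtain ⟨e, rfl⟩ := exists_equiv_dual_of_injective hT
  rw [ContinuousLinearMap.inverse_equiv]
  exact e.symm_apply_apply v

theorem apply_inverse_apply {V : Type*} [NormedAddCommGroup V] [NormedSpace ℝ V]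
    [FiniteDimensional ℝ V] {T : V →L[ℝ] V →L[ℝ] ℝ} (hT : ∀ v, T v = 0 → v = 0)
    (w : V →L[ℝ] ℝ) : T (T.inverse w) = w := by
  obtain ⟨e, rfl⟩ := exists_equiv_dual_of_injective hT
  rw [ContinuousLinearMap.inverse_equiv]
  exact e.apply_symm_apply w

theorem sharp_flat {α : OneForm m M} {x : M} (h : ∀ v, flat α x v = 0 → v = 0) (v : Tan m x) :
    sharp α x (flat α x v) = v :=
  inverse_apply_apply (V := Model m) (T := flat α x) h v

theorem flat_sharp {α : OneForm m M} {x : M} (h : ∀ v, flat α x v = 0 → v = 0)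
    (η : Tan m x →L[ℝ] ℝ) : flat α x (sharp α x η) = η :=
  apply_inverse_apply (V := Model m) (T := flat α x) h η

/-- Evaluation on `v` itself gives `α(v)² = 0`, since `dα` is alternating; the `dα` part must then
vanish too. -/
theorem flat_eq_zero {α : OneForm m M} {x : M} {v : Tan m x} (h : flat α x v = 0) :
    α x v = 0 ∧ extD α x v = 0 := by
  have h1 : α x v = 0 := by
    have := congrArg (fun L : Model m →L[ℝ] ℝ => L v) h
    have h2 : α x v * α x v - extD α x v v = 0 := this
    rw [extD_self, sub_zero] at h2
    exact mul_self_eq_zero.1 h2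
  refine ⟨h1, ?_⟩
  ext w
  have := congrArg (fun L : Model m →L[ℝ] ℝ => L w) h
  have h2 : α x v * α x w - extD α x v w = 0 := this
  rw [h1, zero_mul, zero_sub, neg_eq_zero] at h2
  exact h2

variable [IsManifold (𝓡 m) ∞ M]

/-- The solution `X` of `flat α (X) = η` is smooth if `α` and `η` are. -/
theorem smoothFieldAt_of_flat {α η : OneForm m M} {X : VField m M} {x : M}
    (hα : ∀ᶠ y in 𝓝 x, SmoothFormAt α y) (hinj : ∀ᶠ y in 𝓝 x, ∀ v, flat α y v = 0 → v = 0)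
    (hη : ∀ Y : VField m M, SmoothFieldAt Y x →
      ContMDiffAt (𝓡 m) 𝓘(ℝ, ℝ) ∞ (fun y => η y (Y y)) x)
    (hX : ∀ᶠ y in 𝓝 x, flat α y (X y) = η y) : SmoothFieldAt X x := by
  let B : M → Model m →L[ℝ] Model m := fun y => chartDsymm x (extChartAt (𝓡 m) x y)
  let T : M → Model m →L[ℝ] Model m →L[ℝ] ℝ := fun y => flat α y
  -- `A` and `θ` are `flat α` and `η` in coordinate fields. The coordinates of `X` are then `A⁻¹ θ`,
  -- which is smooth because inversion of linear maps is.
  let A : M → Model m →L[ℝ] Model m →L[ℝ] ℝ := fun y => (T y).bilinearComp (B y) (B y)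
  let θ : M → Model m →L[ℝ] ℝ := fun y => (show Model m →L[ℝ] ℝ from η y).comp (B y)
  have hsrc := extChartAt_source_mem_nhds (I := 𝓡 m) x
  have hco : ∀ v, ∀ᶠ y in 𝓝 x, SmoothFieldAt (coordField (M := M) x v) y := fun v => by
    filter_upwards [hsrc] with y hy using smoothFieldAt_coordField hy v
  have hθ : ContMDiffAt (𝓡 m) 𝓘(ℝ, Model m →L[ℝ] ℝ) ∞ θ x :=
    contMDiffAt_clm_of_apply fun v => hη _ (hco v).self_of_nhds
  have hA : ContMDiffAt (𝓡 m) 𝓘(ℝ, Model m →L[ℝ] Model m →L[ℝ] ℝ) ∞ A x := by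
    refine contMDiffAt_clm_of_apply fun v => contMDiffAt_clm_of_apply fun w => ?_
    exact ((hα.self_of_nhds.contMDiffAt_apply (hco v).self_of_nhds).mul
      (hα.self_of_nhds.contMDiffAt_apply (hco w).self_of_nhds)).sub
      (SmoothFormAt.contMDiffAt_extD_apply hα (hco v) (hco w))
  have hAinj : ∀ᶠ y in 𝓝 x, ∀ v, A y v = 0 → v = 0 := by
    filter_upwards [hinj, hsrc] with y hy hs v hv
    have h1 : T y (B y v) = 0 := by
      ext w
      have h2 := congrArg (fun L : Model m →L[ℝ] ℝ => L (chartD x y w)) hv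
      have h3 : T y (B y v) (B y (chartD x y w)) = 0 := h2
      rwa [chartDsymm_chartD_of_mem_source hs] at h3
    have h2 : B y v = 0 := hy _ h1
    rw [← chartD_chartDsymm_of_mem_source hs v, show chartDsymm x (extChartAt (𝓡 m) x y) v = 0
      from h2, map_zero]
  obtain ⟨e, he⟩ := exists_equiv_dual_of_injective hAinj.self_of_nhds
  have hinv : ContMDiffAt (𝓡 m) 𝓘(ℝ, (Model m →L[ℝ] ℝ) →L[ℝ] Model m) ∞
      (fun y => (A y).inverse) x := by
    have h1 : ContDiffAt ℝ ∞ (ContinuousLinearMap.inverse (M₂ := Model m →L[ℝ] ℝ) (R := ℝ))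
        (A x) := by
      rw [← he]; exact contDiffAt_map_inverse e
    exact h1.contMDiffAt.comp x hA
  refine smoothFieldAt_coord (u := fun y => (A y).inverse (θ y)) (hinv.clm_apply hθ) ?_
  filter_upwards [hX, hAinj, hsrc] with y hy hi hs
  have h1 : B y (chartD x y (X y)) = X y := chartDsymm_chartD_of_mem_source hs _
  have h2 : A y (chartD x y (X y)) = θ y := by
    ext w
    change T y (B y (chartD x y (X y))) (B y w) = η y (B y w)
    rw [h1]
    exact congrArg (fun L : Model m →L[ℝ] ℝ => L (B y w)) hy
  have h3 : (A y).inverse (θ y) = chartD x y (X y) := by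
    rw [← h2]; exact inverse_apply_apply hi _
  change X y = B y ((A y).inverse (θ y))
  rw [h3, h1]

end Flat

/-- Functionals with equal kernels are proportional. This makes the normalized local contact forms
agree on overlaps. -/
theorem inv_smul_eq_of_ker_eq {V : Type*} [NormedAddCommGroup V] [NormedSpace ℝ V]
    {a a' : V →L[ℝ] ℝ} (h : ∀ v, a v = 0 ↔ a' v = 0) {w : V} (hw : a w ≠ 0) :
    (a w)⁻¹ • a = (a' w)⁻¹ • a' := by
  have hw' : a' w ≠ 0 := fun h' => hw ((h w).2 h')
  ext v
  have h1 : a' (v - (a v / a w) • w) = 0 := (h _).1 (by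
    rw [map_sub, map_smul, smul_eq_mul]; field_simp; ring)
  rw [map_sub, map_smul, smul_eq_mul, sub_eq_zero] at h1
  rw [smul_apply, smul_apply, h1, smul_eq_mul, smul_eq_mul]
  field_simp

/-! ### Contact fields, normalized forms and completeness -/

section Contact

variable {n : ℕ} {M : Type*} [TopologicalSpace M] [ChartedSpace (Model (2 * n + 1)) M]
  [IsManifold (𝓡 (2 * n + 1)) ∞ M] {H : Distribution (2 * n + 1) M}
  {α β : OneForm (2 * n + 1) M} {U V : Set M}

theorem Represents.smoothFormAt (h : Represents α U H) {x : M} (hx : x ∈ U) : SmoothFormAt α x :=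
  h.contact.1.smoothFormAt h.isOpen hx

theorem Represents.eq_zero_of_flat_eq_zero (h : Represents α U H) {x : M} (hx : x ∈ U)
    (v : Tan (2 * n + 1) x) (hv : flat α x v = 0) : v = 0 := by
  obtain ⟨w, hw⟩ := h.contact.2 x hx
  obtain ⟨h1, h2⟩ := flat_eq_zero hv
  have h3 : ∀ u : Tan (2 * n + 1) x, extD α x v u = 0 := fun u =>
    congrArg (fun L : Model (2 * n + 1) →L[ℝ] ℝ => L u) h2
  exact eq_zero_of_wedgePow (V := Model (2 * n + 1)) (a := α x) (b := extD α x)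
    finrank_euclideanSpace_fin hw h1 h3 fun u => by
      have h4 := (extD_swap α x u v).trans (congrArg Neg.neg (h3 u))
      exact h4.trans neg_zero

theorem Represents.exists_apply_ne_zero (h : Represents α U H) {x : M} (hx : x ∈ U) :
    ∃ v, α x v ≠ 0 := by
  obtain ⟨w, hw⟩ := h.contact.2 x hx
  exact exists_ne_zero_of_wedgePow (V := Model (2 * n + 1)) (a := α x) (b := extD α x) hw

/-- A contact field scales the value of a contact form on any field which commutes with it. -/
theorem IsContactField.dirDeriv_apply {X : VField (2 * n + 1) M} (hX : IsContactField H X)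
    (h : Represents α U H) :
    ∃ c : M → ℝ, ContMDiffOn (𝓡 (2 * n + 1)) 𝓘(ℝ, ℝ) ∞ c U ∧
      (∀ x ∈ U, lieD X α x = c x • α x) ∧
      ∀ x ∈ U, ∀ Y : VField (2 * n + 1) M, SmoothFieldAt Y x → bracket X Y x = 0 →
        dirDeriv (fun y => α y (Y y)) X x = c x * α x (Y x) := by
  obtain ⟨c, hc, hL⟩ := hX.2 U α h
  refine ⟨c, hc, hL, fun x hx Y hY hXY => ?_⟩
  have h1 := lieD_apply (h.smoothFormAt hx) (hX.1.smoothFieldAt isOpen_univ (mem_univ x)) hY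
  rw [hXY, map_zero, sub_zero, hL x hx] at h1
  exact h1.symm

/-- Tangency to `H` of a field which commutes with an Abelian algebra of contact fields is
invariant. -/
theorem mem_iff_of_mem_orbit (hH : IsContactDistribution H)
    {𝒳 : Submodule ℝ (VField (2 * n + 1) M)} (hc : ∀ X ∈ 𝒳, IsContactField H X)
    {Y : VField (2 * n + 1) M} (hY : ∀ x, SmoothFieldAt Y x)
    (hb : ∀ X ∈ 𝒳, ∀ x, bracket X Y x = 0) {x y : M} (hy : y ∈ orbit 𝒳 x) :
    Y x ∈ H x ↔ Y y ∈ H y := by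
  refine iff_of_mem_orbit (Q := fun x => Y x ∈ H x) (fun X hX γ a b hγ t ht => ?_) hy
  obtain ⟨V, β, htV, hβ⟩ := hH (γ t)
  obtain ⟨c, hcs, -, hcd⟩ := (hc X hX).dirDeriv_apply hβ
  have hγc := continuousWithinAt_curve hγ ht
  have hcc : ContinuousWithinAt (fun s => c (γ s)) (Icc a b) t :=
    (hcs.contMDiffAt (hβ.isOpen.mem_nhds htV)).continuousAt.comp_continuousWithinAt hγc
  have hV : ∀ᶠ s in 𝓝[Icc a b] t, γ s ∈ V := hγc.eventually (hβ.isOpen.mem_nhds htV)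
  have hbd : ∀ᶠ s in 𝓝[Icc a b] t, ‖c (γ s)‖ < ‖c (γ t)‖ + 1 :=
    hcc.norm.eventually_lt continuousWithinAt_const (lt_add_one _)
  -- Along the curve `β(Y)` satisfies the scalar equation `w' = c w`, with `c` the conformal factor
  -- of `X`.
  have key := eventually_eq_zero_iff (w := fun s => β (γ s) (Y (γ s)))
    (L := fun s => c (γ s) • (1 : ℝ →L[ℝ] ℝ)) (K := ‖c (γ t)‖₊ + 1) ht (by
      filter_upwards [hV, hbd, self_mem_nhdsWithin] with s hs hs' hsI
      refine ⟨?_, ?_⟩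
      · rw [norm_smul, norm_one, mul_one]
        exact hs'.le
      · have h1 := hasDerivWithinAt_comp_curve hγ hsI
          (((hβ.smoothFormAt hs).contMDiffAt_apply (hY _)).mdifferentiableAt (by simp))
        rw [hcd _ hs Y (hY _) (hb X hX _)] at h1
        exact h1)
  filter_upwards [key, hV] with s hs hsV
  rw [hβ.ker_eq _ htV, hβ.ker_eq _ hsV]
  exact hs

/-- Where the field `X` is transversal to the contact distribution `H`, there is a contact form
representing `H` which is equal to `1` on `X`. -/
theorem exists_normalized_form (hH : IsContactDistribution H) {X : VField (2 * n + 1) M}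
    (hX : ∀ x, SmoothFieldAt X x) :
    ∃ α : OneForm (2 * n + 1) M, Represents α {x | X x ∉ H x} H ∧
      ∀ x, X x ∉ H x → α x (X x) = 1 := by
  choose V β hxV hβ using hH
  -- A different local form is used at every point; near a point where `X` is transversal these
  -- choices agree with the normalization of a single one. Elsewhere the inverse is `0` and so is
  -- `α`.
  let α : OneForm (2 * n + 1) M := fun x => (β x x (X x))⁻¹ • β x x
  have hne : ∀ x y, y ∈ V x → X y ∉ H y → β x y (X y) ≠ 0 := fun x y hy hXy h =>
    hXy (((hβ x).ker_eq y hy _).2 h)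
  have hα : ∀ x y, y ∈ V x → X y ∉ H y → α y = (β x y (X y))⁻¹ • β x y := fun x y hy hXy =>
    inv_smul_eq_of_ker_eq (V := Model (2 * n + 1)) (a := β y y) (a' := β x y)
      (fun v => ((hβ y).ker_eq y (hxV y) v).symm.trans ((hβ x).ker_eq y hy v))
      (hne y y (hxV y) hXy)
  have hsm : ∀ x, ContMDiffAt (𝓡 (2 * n + 1)) 𝓘(ℝ, ℝ) ∞ (fun y => β x y (X y)) x := fun x =>
    ((hβ x).smoothFormAt (hxV x)).contMDiffAt_apply (hX x)
  have hnear : ∀ x, X x ∉ H x → ∀ᶠ y in 𝓝 x, y ∈ V x ∧ X y ∉ H y := by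
    intro x hx
    filter_upwards [(hβ x).isOpen.mem_nhds (hxV x),
      (hsm x).continuousAt.eventually_ne (hne x x (hxV x) hx)] with y h1 h2
    exact ⟨h1, fun h => h2 (((hβ x).ker_eq y h1 _).1 h)⟩
  have hαev : ∀ x, X x ∉ H x → ∀ᶠ y in 𝓝 x, α y = (β x y (X y))⁻¹ • β x y := fun x hx => by
    filter_upwards [hnear x hx] with y hy using hα x y hy.1 hy.2
  have hg : ∀ x, X x ∉ H x → ContMDiffAt (𝓡 (2 * n + 1)) 𝓘(ℝ, ℝ) ∞
      (fun y => (β x y (X y))⁻¹) x := fun x hx => (hsm x).inv₀ (hne x x (hxV x) hx)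
  refine ⟨α, ⟨?_, ⟨?_, ?_⟩, ?_⟩, ?_⟩
  · refine isOpen_iff_mem_nhds.2 fun x hx => ?_
    filter_upwards [hnear x hx] with y hy using hy.2
  · intro x hx
    exact (((hβ x).smoothFormAt (hxV x)).congr_smul (hg x hx) (hαev x hx)).contMDiffWithinAt
  · intro x hx
    obtain ⟨v, hv⟩ := (hβ x).contact.2 x (hxV x)
    exact exists_wedgePow_smul_ne_zero (V := Model (2 * n + 1)) (a := β x x) (b := extD (β x) x)
      finrank_euclideanSpace_fin hv (a' := α x) (b' := extD α x)
      (inv_ne_zero (hne x x (hxV x) hx)) rfl fun u w hu hw =>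
        extD_of_eventuallyEq_smul ((hβ x).smoothFormAt (hxV x)) (hg x hx) (hαev x hx) hu hw
  · intro x hx v
    rw [(hβ x).ker_eq x (hxV x)]
    change _ ↔ (β x x (X x))⁻¹ * β x x v = 0
    rw [mul_eq_zero, or_iff_right (inv_ne_zero (hne x x (hxV x) hx))]
  · intro x hx
    exact inv_mul_cancel₀ (hne x x (hxV x) hx)

/-- The conformal factor of `X` is read off on `Z`: it equals the derivative along `X` of the
constant `α(Z) = 1`. -/
theorem lieD_eq_zero_of_normalized (h : Represents α U H) {X Z : VField (2 * n + 1) M}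
    (hX : IsContactField H X) (hZ : ∀ x, SmoothFieldAt Z x) (hXZ : ∀ x, bracket X Z x = 0)
    (hαZ : ∀ x ∈ U, α x (Z x) = 1) {x : M} (hx : x ∈ U) : lieD X α x = 0 := by
  obtain ⟨c, -, hL, hd⟩ := hX.dirDeriv_apply h
  have h1 := hd x hx Z (hZ x) (hXZ x)
  rw [dirDeriv_eq_zero_of_eventually_const (c := 1), hαZ x hx, mul_one] at h1
  · rw [hL x hx, ← h1, zero_smul]
  · filter_upwards [h.isOpen.mem_nhds hx] with y hy using hαZ y hy

/-- If `α` is invariant under an algebra of fields which spans `F` and contains the Reeb field,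
then `F` is `α`-complete. -/
theorem isAlphaComplete_of_lieD_eq_zero (hα : Represents α U H)
    {𝒳 : Submodule ℝ (VField (2 * n + 1) M)} (hs : ∀ X ∈ 𝒳, ∀ x, SmoothFieldAt X x)
    (hL : ∀ X ∈ 𝒳, ∀ x ∈ U, lieD X α x = 0) {Z : VField (2 * n + 1) M} (hZ : Z ∈ 𝒳)
    (hαZ : ∀ x ∈ U, α x (Z x) = 1) {F : Distribution (2 * n + 1) M}
    (hF : ∀ x v, v ∈ F x ↔ ∃ X ∈ 𝒳, X x = v) : IsAlphaComplete α F U := by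
  intro V hV hVU f g hf hg
  have hdZ : ∀ x ∈ U, extD α x (Z x) = 0 := by
    intro x hx
    have h1 : extD α x (Z x) + diff (fun y => α y (Z y)) x = 0 := hL Z hZ x hx
    rwa [diff_eq_zero_of_eventually_const (c := 1), add_zero] at h1
    filter_upwards [hα.isOpen.mem_nhds hx] with y hy using hαZ y hy
  have hreeb : ∀ x ∈ U, reeb α x = Z x := by
    intro x hx
    have h1 : flat α x (Z x) = α x := by
      have h2 : flat α x (Z x) = α x (Z x) • α x - extD α x (Z x) := rfl
      rw [h2, hαZ x hx, hdZ x hx, one_smul, sub_zero]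
    have h3 := sharp_flat (hα.eq_zero_of_flat_eq_zero hx) (Z x)
    rwa [h1] at h3
  have hinj := fun x hx => hα.eq_zero_of_flat_eq_zero (x := x) hx
  have hαs : ∀ x ∈ U, ∀ᶠ y in 𝓝 x, SmoothFormAt α y := fun x hx => by
    filter_upwards [hα.isOpen.mem_nhds hx] with y hy using hα.smoothFormAt hy
  have hint : ∀ f, IsFirstIntegral F V f → ∀ Y ∈ 𝒳, ∀ x ∈ V, dirDeriv f Y x = 0 :=
    fun f hf Y hY x hx => hf.2 x hx _ ((hF x _).2 ⟨Y, hY, rfl⟩)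
  -- Since `Z` is the Reeb field and lies in `F`, `df(Z) = 0` and `X_f` is the preimage of `f α +
  -- df`.
  have hflat : ∀ f, IsFirstIntegral F V f → ∀ x ∈ V,
      flat α x (hamField α f x) = f x • α x + diff f x := by
    intro f hf x hx
    have h1 : diff f x (Z x) = 0 := hint f hf Z hZ x hx
    have h2 : flat α x (sharp α x (α x)) = α x := flat_sharp (hinj x (hVU hx)) _
    have h3 : hamField α f x = f x • sharp α x (α x) + sharp α x (diff f x) := by
      have : hamField α f x =
        f x • reeb α x + sharp α x (diff f x - diff f x (reeb α x) • α x) := rfl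
      rw [this, hreeb x (hVU hx), h1, zero_smul, sub_zero, ← hreeb x (hVU hx)]
      rfl
    rw [h3, map_add, map_smul, h2, flat_sharp (hinj x (hVU hx))]
  have hαH : ∀ f, IsFirstIntegral F V f → ∀ x ∈ V, α x (hamField α f x) = f x := by
    intro f hf x hx
    have h1 := congrArg (fun L : Model (2 * n + 1) →L[ℝ] ℝ => L (Z x)) (hflat f hf x hx)
    have h2 : α x (hamField α f x) * α x (Z x) - extD α x (hamField α f x) (Z x) =
      f x * α x (Z x) + diff f x (Z x) := h1
    have h3 : diff f x (Z x) = 0 := hint f hf Z hZ x hx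
    have h4 : extD α x (Z x) (hamField α f x) = 0 :=
      congrArg (fun L : Model (2 * n + 1) →L[ℝ] ℝ => L (hamField α f x)) (hdZ x (hVU hx))
    rw [extD_swap, h4, hαZ x (hVU hx), h3] at h2
    linarith
  have hLH : ∀ f, IsFirstIntegral F V f → ∀ x ∈ V, lieD (hamField α f) α x = 0 := by
    intro f hf x hx
    have h1 : diff (m := 2 * n + 1) (fun y => α y (hamField α f y)) x = diff f x := by
      have h2 : (fun y => α y (hamField α f y)) =ᶠ[𝓝 x] f := by
        filter_upwards [hV.mem_nhds hx] with y hy using hαH f hf y hy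
      exact h2.mfderiv_eq
    have h3 : extD α x (hamField α f x) =
      α x (hamField α f x) • α x - flat α x (hamField α f x) := (sub_sub_cancel _ _).symm
    have h4 : lieD (hamField α f) α x =
      extD α x (hamField α f x) + diff (fun y => α y (hamField α f y)) x := rfl
    rw [h4, h3, h1, hflat f hf x hx, hαH f hf x hx]
    abel
  have hsH : ∀ f, IsFirstIntegral F V f → ∀ x ∈ V, SmoothFieldAt (hamField α f) x := by
    intro f hf x hx
    have hfx : ContMDiffAt (𝓡 (2 * n + 1)) 𝓘(ℝ, ℝ) ∞ f x := hf.1.contMDiffAt (hV.mem_nhds hx)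
    refine smoothFieldAt_of_flat (η := fun y => f y • α y + diff f y) (hαs x (hVU hx)) ?_ ?_ ?_
    · filter_upwards [hV.mem_nhds hx] with y hy using hinj y (hVU hy)
    · intro Y hY
      exact (hfx.mul ((hα.smoothFormAt (hVU hx)).contMDiffAt_apply hY)).add
        (hY.contMDiffAt_dirDeriv hfx)
    · filter_upwards [hV.mem_nhds hx] with y hy using hflat f hf y hy
  -- The bracket preserves `α` and has `α`-value `Y(f) = 0`, so `dα` annihilates it as well;
  -- nondegeneracy leaves only zero.
  have hcomm : ∀ f, IsFirstIntegral F V f → ∀ Y ∈ 𝒳, ∀ x ∈ V,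
      bracket Y (hamField α f) x = 0 := by
    intro f hf Y hY
    have h0 : ∀ x ∈ V, α x (bracket Y (hamField α f) x) = 0 := by
      intro x hx
      have h1 := lieD_apply (hα.smoothFormAt (hVU hx)) (hs Y hY x) (hsH f hf x hx)
      rw [hL Y hY x (hVU hx), dirDeriv_congr (h₂ := f), hint f hf Y hY x hx, zero_sub] at h1
      · exact neg_eq_zero.1 h1.symm
      · filter_upwards [hV.mem_nhds hx] with y hy using hαH f hf y hy
    intro x hx
    have h1 : extD α x (bracket Y (hamField α f) x) +
        diff (fun y => α y (bracket Y (hamField α f) y)) x = 0 := by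
      refine lieD_bracket_eq_zero (hαs x (hVU hx)) (Eventually.of_forall (hs Y hY)) ?_ ?_ ?_ <;>
        filter_upwards [hV.mem_nhds hx] with y hy
      exacts [hsH f hf y hy, hL Y hY y (hVU hy), hLH f hf y hy]
    rw [diff_eq_zero_of_eventually_const (c := 0), add_zero] at h1
    · refine hinj x (hVU hx) _ ?_
      have h2 : flat α x (bracket Y (hamField α f) x) =
        α x (bracket Y (hamField α f) x) • α x - extD α x (bracket Y (hamField α f) x) := rfl
      rw [h2, h0 x hx, h1, zero_smul, sub_zero]
    · filter_upwards [hV.mem_nhds hx] with y hy using h0 y hy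
  refine ⟨fun x hx => ?_, fun x hx v hv => ?_⟩
  · exact ((hα.smoothFormAt (hVU hx)).contMDiffAt_apply
      ((hsH f hf x hx).bracket (hsH g hg x hx))).contMDiffWithinAt
  · obtain ⟨Y, hY, rfl⟩ := (hF x v).1 hv
    have h1 := lieD_apply (hα.smoothFormAt (hVU hx)) (hs Y hY x)
      ((hsH f hf x hx).bracket (hsH g hg x hx))
    -- By the Jacobi identity, from `[Y, X_f] = [Y, X_g] = 0` on a neighborhood.
    have h2 : bracket Y (bracket (hamField α f) (hamField α g)) x = 0 := by
      rw [bracket_bracket (hs Y hY x) (hsH f hf x hx) (hsH g hg x hx),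
        bracket_eq_zero_of_eventually_zero_left, bracket_eq_zero_of_eventually_zero_right, add_zero]
      · filter_upwards [hV.mem_nhds hx] with y hy using hcomm g hg Y hY y hy
      · filter_upwards [hV.mem_nhds hx] with y hy using hcomm f hf Y hY y hy
    rw [hL Y hY x (hVU hx), h2, map_zero, sub_zero] at h1
    exact h1.symm

end Contact

end ContactGeometry

end

/-! ### Choice of the normalizing field and conclusion -/

open scoped Manifold ContDiff in
open ContactGeometry in
theorem theorem3 {n p : ℕ}
    {M : Type*} [TopologicalSpace M] [T2Space M] [SecondCountableTopology M]
    [ChartedSpace (Model (2 * n + 1)) M] [IsManifold (𝓡 (2 * n + 1)) ∞ M]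
    {W : Type*} [TopologicalSpace W] [T2Space W] [SecondCountableTopology W]
    [ChartedSpace (Model p) W] [IsManifold (𝓡 p) ∞ W]
    (H : Distribution (2 * n + 1) M) (𝒳 : Submodule ℝ (VField (2 * n + 1) M)) (π : M → W)
    (h : IsCompletePreIsotropic p H 𝒳 π) :
    ∀ x₀ : M, ∃ (U : Set M) (α : OneForm (2 * n + 1) M),
      IsOpen U ∧ x₀ ∈ U ∧ IsInvariantSet 𝒳 U ∧
      Represents α U H ∧
      (∀ X ∈ 𝒳, ∀ x ∈ U, lieD X α x = 0) ∧
      IsAlphaComplete α (vertical p π) U := by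
  intro x₀
  have hs : ∀ X ∈ 𝒳, ∀ x, SmoothFieldAt X x := fun X hX x =>
    (h.contactField X hX).1.smoothFieldAt isOpen_univ (Set.mem_univ x)
  obtain ⟨C, _, _, hC⟩ := h.submersion
  have hF : ∀ x v, v ∈ vertical p π x ↔ ∃ X ∈ 𝒳, X x = v := by
    refine fun x v => ⟨fun hv => exists_eq_of_mfderiv_eq_zero hs h.abelian (hC x) (h.orbit_eq x) hv,
      ?_⟩
    rintro ⟨X, hX, rfl⟩
    exact mfderiv_eq_zero_of_orbit_subset hs ((hC x).contMDiffAt.mdifferentiableAt (by simp))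
      (h.orbit_eq x ▸ connectedComponentIn_subset _ _) hX
  -- Otherwise `F ≤ H` at `x₀`, because `𝒳` spans `F`; transversality would make `H` the whole
  -- tangent space, although a contact form does not vanish.
  obtain ⟨Z, hZ, hZ₀⟩ : ∃ Z ∈ 𝒳, Z x₀ ∉ H x₀ := by
    by_contra! hcon
    obtain ⟨V, β, hxV, hβ⟩ := h.contact x₀
    obtain ⟨v, hv⟩ := hβ.exists_apply_ne_zero hxV
    refine hv ((hβ.ker_eq x₀ hxV v).1 ?_)
    have hle : vertical p π x₀ ≤ H x₀ := fun w hw => by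
      obtain ⟨X, hX, rfl⟩ := (hF x₀ w).1 hw
      exact hcon X hX
    have htop := h.preIsotropic.transversal x₀
    rw [sup_eq_right.2 hle] at htop
    rw [htop]
    exact Submodule.mem_top
  obtain ⟨α, hα, hαZ⟩ := exists_normalized_form h.contact (hs Z hZ)
  have hL : ∀ X ∈ 𝒳, ∀ x ∈ {x | Z x ∉ H x}, lieD X α x = 0 := fun X hX x hx =>
    lieD_eq_zero_of_normalized hα (h.contactField X hX) (hs Z hZ) (h.abelian X hX Z hZ) hαZ hx
  refine ⟨{x | Z x ∉ H x}, α, hα.isOpen, hZ₀, fun x hx y hy => ?_, hα, hL,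
    isAlphaComplete_of_lieD_eq_zero hα hs hL hZ hαZ hF⟩
  exact fun hy' => hx ((mem_iff_of_mem_orbit h.contact h.contactField (hs Z hZ)
    (fun X hX => h.abelian X hX Z hZ) hy).2 hy')
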